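/- Let $G$ be a finite simple graph with $m$ edges. For each edge $\langle jk\rangle$ let $C_{\langle jk\rangle}=\tfrac12(1-Z_jZ_k)$, acting on one qubit per vertex, and put $C=\sum_{\langle jk\rangle}C_{\langle jk\rangle}$ (the MaxCut cost operator) and $B=\sum_j X_j$. For $p\in\mathbb N$ and angles $\gamma,\beta\in\mathbb R^p$ let $$|\gamma,\beta\rangle=e^{-i\beta_pB}e^{-i\gamma_pC}\cdots e^{-i\beta_1B}e^{-i\gamma_1C}|s\rangle ,$$ where $|s\rangle$ is the uniform superposition of all bit strings, and let $$F_p(\gamma,\beta)=\langle\gamma,\beta|C|\gamma,\beta\rangle,\qquad F_e(\gamma,\beta)=\langle\gamma,\beta|C_e|\gamma,\beta\rangle .$$ We write $F_p^G$, $F_e^G$ when the graph matters. The radius-$p$ neighborhood of an edge $e$ is the subgraph of $G$ whose vertices are those at distance at most $p$ from an endpoint of $e$ and whose edges are $e$ and all edges with an end at distance less than $p$ from an endpoint of $e$. Let $T_p$ be the tree of depth $p$ around a central edge, in which each of the two endpoints of the central edge, and each of their descendants, at depth less than $p$ has exactly two children; let $F_{\mathrm{tree}}(\gamma,\beta)$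 be the term of the central edge for the graph $T_p$. For $m>0$ let $f_p(G)$ be the fraction of the edges of $G$ whose radius-$p$ neighborhood is not a tree. Fix $p$. Then: 1. For every finite graph, $F_p(\gamma,\beta)=\sum_e F_e(\gamma,\beta)$ for all $\gamma,\beta$. 2. $F_e$ is determined by the radius-$p$ neighborhood of $e$: if $e$ is an edge of $G$, $e'$ is an edge of $G'$ and there is an isomorphism between their radius-$p$ neighborhoods that maps the endpoints of $e$ to those of $e'$, then $F_e^{G}(\gamma,\beta)=F_{e'}^{G'}(\gamma,\beta)$ for all $\gamma,\beta$. 3. If $G$ is 3-regular and the radius-$p$ neighborhood of the edge $e$ is a tree, then $F_e(\gamma,\beta)=F_{\mathrm{tree}}(\gamma,\beta)$ for all $\gamma,\beta$. Consequently $|F_p(\gamma,\beta)/m-F_{\mathrm{tree}}(\gamma,\beta)|\le f_p(G)$ for every nonempty finite 3-regular graph $G$ and all $\gamma,\beta$. 4. For a uniformly random 3-regular graph $G$ on $n$ labelled vertices ($n\ge4$ even), the non-tree fraction is $O(1/n)$ in mean: there is a constant $K$ depending only on $p$ with $\mathbb E[f_p(G)]\le K/n$ for all even $n\ge 4$. 5.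 The landscape concentrates. For every $\varepsilon>0$ there is a constant $K$ depending only on $p$ and $\varepsilon$ such that for all even $n\ge4$, with probability at least $1-\varepsilon$, $$f_p(G)\le K/n\quad\text{and}\quad |F_p(\gamma,\beta)/m-F_{\mathrm{tree}}(\gamma,\beta)|\le K/n\ \text{ for all }\gamma,\beta .$$ In particular, for every $\delta>0$ the probability that $|F_p(\gamma,\beta)/m-F_{\mathrm{tree}}(\gamma,\beta)|\le\delta$ for all $\gamma,\beta$ tends to $1$ as $n\to\infty$ through even integers. 6. The landscape is essentially independent of the instance: for every $\varepsilon>0$ there is a constant $K$ depending only on $p$ and $\varepsilon$ such that for all even $n\ge4$, two independent uniformly random 3-regular graphs $G,G'$ on $n$ vertices satisfy, with probability at least $1-\varepsilon$, $|F_p^{G}(\gamma,\beta)/m-F_p^{G'}(\gamma,\beta)/m|\le K/n$ for all $\gamma,\beta$, where $m=3n/2$. -/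

import Mathlib

open scoped Classical Matrix
open Filter Topology Finset

noncomputable section

namespace QAOA

/-! ### The QAOA for MaxCut -/

section Circuit

variable {V : Type*} [Fintype V]

/-- Operators on the Hilbert space of dimension `2 ^ |V|` whose computational basis is indexed by
the bit strings `z : V → Bool` (one qubit for each vertex). -/
abbrev Operator (V : Type*) : Type _ := Matrix (V → Bool) (V → Bool) ℂ

/-- The Pauli operator `Z` on qubit `j`. -/
def pauliZ (j : V) : Operator V :=
  Matrix.diagonal fun z => if z j then -1 else 1

/-- The Pauli operator `X` on qubit `j`; it flips bit `j`. -/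
def pauliX (j : V) : Operator V :=
  Matrix.of fun z w => if w = Function.update z j (!z j) then 1 else 0

/-- The MaxCut clause `(1 - Z_j Z_k) / 2` of the pair `{j, k}`. -/
def clauseOp (e : Sym2 V) : Operator V :=
  Sym2.lift ⟨fun j k => (1 / 2 : ℂ) • (1 - pauliZ j * pauliZ k), fun j k => by
    simp only [pauliZ, Matrix.diagonal_mul_diagonal, mul_comm]⟩ e

/-- The MaxCut cost operator: the sum of the clauses of all edges. -/
def costOp (G : SimpleGraph V) : Operator V :=
  ∑ e ∈ G.edgeFinset, clauseOp e

/-- The operator `B`, the sum of all `X_j`. -/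
def mixerOp (V : Type*) [Fintype V] : Operator V :=
  ∑ j : V, pauliX j

/-- `U(C, γ) = exp (-i γ C)`. -/
def costUnitary (G : SimpleGraph V) (γ : ℝ) : Operator V :=
  NormedSpace.exp ((-(Complex.I * (γ : ℂ))) • costOp G)

/-- `U(B, β) = exp (-i β B)`. -/
def mixerUnitary (V : Type*) [Fintype V] (β : ℝ) : Operator V :=
  NormedSpace.exp ((-(Complex.I * (β : ℂ))) • mixerOp V)

/-- The uniform superposition of all bit strings. -/
def uniformState (V : Type*) [Fintype V] : (V → Bool) → ℂ :=
  fun _ => 1 / (Real.sqrt (2 ^ Fintype.card V) : ℂ)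

/-- The depth `p` state `U(B, β_p) U(C, γ_p) ⋯ U(B, β_1) U(C, γ_1) |s⟩`; the angle `γ_i` is
`γ (i - 1)`, so that the last index is applied last. -/
def state (G : SimpleGraph V) : (p : ℕ) → (Fin p → ℝ) → (Fin p → ℝ) → (V → Bool) → ℂ
  | 0, _, _ => uniformState V
  | p + 1, γ, β =>
    mixerUnitary V (β (Fin.last p)) *ᵥ
      (costUnitary G (γ (Fin.last p)) *ᵥ
        state G p (fun i => γ i.castSucc) (fun i => β i.castSucc))

/-- The expectation `⟨ψ| A |ψ⟩`, which is a real number for the Hermitian operators `A` used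
below. -/
def expectation (A : Operator V) (ψ : (V → Bool) → ℂ) : ℝ :=
  (star ψ ⬝ᵥ (A *ᵥ ψ)).re

/-- The objective function `F_p(γ, β)` of the instance `G`. -/
def objective (G : SimpleGraph V) {p : ℕ} (γ β : Fin p → ℝ) : ℝ :=
  expectation (costOp G) (state G p γ β)

/-- The contribution of the single edge `e` to the objective function of `G`. -/
def edgeTerm (G : SimpleGraph V) (e : Sym2 V) {p : ℕ} (γ β : Fin p → ℝ) : ℝ :=
  expectation (clauseOp e) (state G p γ β)

end Circuit

/-! ### Neighborhoods of edges -/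

section Neighborhood

variable {V : Type*}

/-- The radius `p` neighborhood of the edge `e`: its vertices are those at distance at most `p`
from an endpoint of `e`, and its edges are `e` and all edges of `G` that have an end at distance
less than `p` from an endpoint of `e`. (An edge between two vertices that both have distance `p`
does not belong to it.) -/
def edgeNbhd (G : SimpleGraph V) (e : Sym2 V) (p : ℕ) : G.Subgraph where
  verts := {v | ∃ w ∈ e, G.edist w v ≤ p}
  Adj u v := G.Adj u v ∧
    (s(u, v) = e ∨ (∃ w ∈ e, G.edist w u < p) ∨ (∃ w ∈ e, G.edist w v < p))
  adj_sub h := h.1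
  edge_vert := by
    rintro u v ⟨huv, h | ⟨w, hw, h⟩ | ⟨w, hw, h⟩⟩
    · exact ⟨u, h ▸ Sym2.mem_mk_left u v, by simp⟩
    · exact ⟨w, hw, h.le⟩
    · refine ⟨w, hw, ?_⟩
      have h1 : G.edist v u ≤ 1 := by
        simpa using (SimpleGraph.Walk.cons huv.symm SimpleGraph.Walk.nil).edist_le
      calc G.edist w u ≤ G.edist w v + G.edist v u := G.edist_triangle
        _ ≤ G.edist w v + 1 := by gcongr
        _ ≤ p := Order.add_one_le_of_lt h
  symm := ⟨by
    rintro u v ⟨huv, h⟩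
    refine ⟨huv.symm, ?_⟩
    rcases h with h | h | h
    · exact Or.inl (Sym2.eq_swap.trans h)
    · exact Or.inr (Or.inr h)
    · exact Or.inr (Or.inl h)⟩

/-- The neighborhood of `e` in `G` and the neighborhood of `f` in `H` are isomorphic as graphs with
a distinguished edge. -/
def SameNbhd {W : Type*} (G : SimpleGraph V) (e : Sym2 V) (H : SimpleGraph W) (f : Sym2 W)
    (p : ℕ) : Prop :=
  ∃ φ : (edgeNbhd G e p).coe ≃g (edgeNbhd H f p).coe,
    ∀ v : (edgeNbhd G e p).verts, (v : V) ∈ e ↔ (φ v : W) ∈ f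

/-- The radius `p` neighborhood of `e` is a tree. -/
def IsTreeLike (G : SimpleGraph V) (e : Sym2 V) (p : ℕ) : Prop :=
  (edgeNbhd G e p).coe.IsTree

/-- The fraction of the edges of `G` whose radius `p` neighborhood is not a tree. -/
def nonTreeFraction [Fintype V] (G : SimpleGraph V) (p : ℕ) : ℝ :=
  (#{e ∈ G.edgeFinset | ¬ IsTreeLike G e p} : ℝ) / #G.edgeFinset

end Neighborhood

/-! ### The tree term -/

/-- Vertices of the tree of depth `p` around an edge: an endpoint of the central edge and
a descending path of at most `p` binary choices (most recent choice first). -/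
abbrev TreeVertex (p : ℕ) : Type := Bool × {l : List Bool // l.length ≤ p}

instance (p : ℕ) : Fintype {l : List Bool // l.length ≤ p} :=
  (List.finite_length_le Bool p).fintype

/-- The tree of depth `p` around an edge: the two endpoints of the central edge are adjacent,
and every vertex at depth less than `p` has two children, hence degree three. -/
def edgeTree (p : ℕ) : SimpleGraph (TreeVertex p) :=
  SimpleGraph.fromRel fun x y =>
    (x.2.1 = [] ∧ y.2.1 = [] ∧ x.1 ≠ y.1) ∨ (x.1 = y.1 ∧ ∃ b, y.2.1 = b :: x.2.1)

/-- The central edge of `edgeTree p`. -/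
def centralEdge (p : ℕ) : Sym2 (TreeVertex p) :=
  s((false, ⟨[], Nat.zero_le p⟩), (true, ⟨[], Nat.zero_le p⟩))

/-- The tree-neighborhood term: the contribution of the central edge of the depth `p` tree. -/
def treeTerm {p : ℕ} (γ β : Fin p → ℝ) : ℝ :=
  edgeTerm (edgeTree p) (centralEdge p) γ β

/-! ### Uniformly random 3-regular graphs -/

/-- The 3-regular simple graphs on the vertex set `{0, …, n - 1}`. -/
def cubicGraphs (n : ℕ) : Finset (SimpleGraph (Fin n)) :=
  {G | G.IsRegularOfDegree 3}

/-- The probability of `P` for a uniformly random 3-regular graph on `n` vertices. -/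
def cubicProb (n : ℕ) (P : SimpleGraph (Fin n) → Prop) : ℝ :=
  (#{G ∈ cubicGraphs n | P G} : ℝ) / #(cubicGraphs n)

/-- The mean of `X` for a uniformly random 3-regular graph on `n` vertices. -/
def cubicMean (n : ℕ) (X : SimpleGraph (Fin n) → ℝ) : ℝ :=
  (∑ G ∈ cubicGraphs n, X G) / #(cubicGraphs n)

/-- The probability of `P` for two independent uniformly random 3-regular graphs on `n`
vertices. -/
def cubicPairProb (n : ℕ) (P : SimpleGraph (Fin n) → SimpleGraph (Fin n) → Prop) : ℝ :=
  (#{q ∈ cubicGraphs n ×ˢ cubicGraphs n | P q.1 q.2} : ℝ) / #(cubicGraphs n ×ˢ cubicGraphs n)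

/-- The objective function of `G` divided by the number of edges. -/
def objectivePerEdge {V : Type*} [Fintype V] (G : SimpleGraph V) {p : ℕ} (γ β : Fin p → ℝ) : ℝ :=
  objective G γ β / #G.edgeFinset

end QAOA

end

/-! In the Heisenberg picture an edge term is the expectation of a clause, conjugated by all layers,
in the uniform state. A summand of the generator that commutes with the other summands and with the
observable cancels (`evolve_add`). So the mixer does not enlarge the support of an observable and
the cost operator enlarges it by one graph step: `p` layers see only the radius-`p` neighborhood.
`expectation_extend_state` makes this precise for an injective homomorphism `ι` from `N` to `G` that
hits every edge of `G` at the inner vertices: `extend ι` is an algebra homomorphism, intertwines the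
two evolutions on observables of small support, and preserves expectations in the uniform state.

In a 3-regular graph the binary tree around an edge maps to `G` as a truncated universal cover. This
map is locally injective, hence injective when the neighborhood it lands in is acyclic
(`injective_of_locally_injective`); then the edge term is the tree term. All terms lie in `[0, 1]`,
so the deviation per edge is at most the non-tree fraction.

Randomness enters only through this fraction. A non-tree neighborhood contains an edge on a cycle of
length bounded in terms of `p`, and each such edge spoils boundedly many neighborhoods. Switching a
short-cycle edge `xy` with a distant edge `ab` gives a cubic graph in which `x` and `y` are still
close, and the switching can be undone. There are at least `n - O(1)` distant edges to choose from,
but a cubic graph has only `O(n)` close pairs, so the mean number of short-cycle edges is `O(1)`.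
Markov's inequality gives the rest, uniformly in the angles because the exceptional event depends on
the graph alone. -/

noncomputable section

namespace QAOA

/-! ### Heisenberg evolution of observables -/

section Evolution

open NormedSpace

variable {V : Type*} [Fintype V]

/-- `exp (-i θ A)`. -/
def unitaryExp (θ : ℝ) (A : Operator V) : Operator V :=
  exp ((-(Complex.I * (θ : ℂ))) • A)

/-- Heisenberg evolution of the observable `O` by `exp (-i θ A)`. -/
def evolve (θ : ℝ) (A O : Operator V) : Operator V :=
  unitaryExp (-θ) A * O * unitaryExp θ A

theorem unitaryExp_commute {A D : Operator V} (h : Commute A D) (θ : ℝ) :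
    Commute (unitaryExp θ A) D :=
  (h.smul_left _).exp_left

theorem unitaryExp_add {A B : Operator V} (h : Commute A B) (θ : ℝ) :
    unitaryExp θ (A + B) = unitaryExp θ A * unitaryExp θ B := by
  rw [unitaryExp, smul_add, Matrix.exp_add_of_commute _ _ ((h.smul_left _).smul_right _)]
  rfl

theorem unitaryExp_neg_mul_self (A : Operator V) (θ : ℝ) :
    unitaryExp (-θ) A * unitaryExp θ A = 1 := by
  rw [unitaryExp, unitaryExp, ← Matrix.exp_add_of_commute, ← add_smul]
  · simp
  · exact ((Commute.refl A).smul_left _).smul_right _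

theorem unitaryExp_conjTranspose {A : Operator V} (hA : A.IsHermitian) (θ : ℝ) :
    (unitaryExp θ A)ᴴ = unitaryExp (-θ) A := by
  rw [unitaryExp, unitaryExp, ← Matrix.exp_conjTranspose, Matrix.conjTranspose_smul, hA.eq]
  congr 2
  simp [Complex.conj_ofReal]

theorem evolve_commute {A O D : Operator V} (hA : Commute A D) (hO : Commute O D) (θ : ℝ) :
    Commute (evolve θ A O) D :=
  ((unitaryExp_commute hA _).mul_left hO).mul_left (unitaryExp_commute hA _)

/-- A part of the generator that commutes with everything else does not contribute. -/
theorem evolve_add {A B O : Operator V} (hAB : Commute A B) (hBO : Commute B O) (θ : ℝ) :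
    evolve θ (A + B) O = evolve θ A O := by
  have h1 : Commute (unitaryExp θ B) O := unitaryExp_commute hBO θ
  have h2 : unitaryExp θ (A + B) = unitaryExp θ B * unitaryExp θ A := by
    rw [add_comm, unitaryExp_add hAB.symm]
  rw [evolve, unitaryExp_add hAB, h2, evolve]
  calc _ = unitaryExp (-θ) A * (unitaryExp (-θ) B * (O * unitaryExp θ B)) * unitaryExp θ A := by
        noncomm_ring
    _ = _ := by
        rw [← h1.eq, ← mul_assoc (unitaryExp (-θ) B), unitaryExp_neg_mul_self, one_mul]

theorem expectation_unitaryExp_mulVec {A : Operator V} (hA : A.IsHermitian) (O : Operator V)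
    (θ : ℝ) (ψ : (V → Bool) → ℂ) :
    expectation O (unitaryExp θ A *ᵥ ψ) = expectation (evolve θ A O) ψ := by
  rw [expectation, expectation, evolve, ← unitaryExp_conjTranspose hA, Matrix.star_mulVec,
    ← Matrix.dotProduct_mulVec, Matrix.mulVec_mulVec, Matrix.mulVec_mulVec, mul_assoc]

end Evolution

/-! ### Pauli algebra, clauses and bounds on edge terms -/

section Pauli

variable {V : Type*} [Fintype V]

theorem pauliZ_commute (j k : V) : Commute (pauliZ j) (pauliZ k) := by
  simp only [Commute, SemiconjBy, pauliZ, Matrix.diagonal_mul_diagonal, mul_comm]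

/-- Flip the bit `j`. -/
def flipBit {V : Type*} (j : V) (z : V → Bool) : V → Bool :=
  Function.update z j (!z j)

theorem flipBit_apply {V : Type*} (j k : V) (z : V → Bool) :
    flipBit j z k = if k = j then !z j else z k :=
  Function.update_apply ..

theorem flipBit_flipBit {V : Type*} (j : V) (z : V → Bool) : flipBit j (flipBit j z) = z := by
  ext x
  simp only [flipBit_apply]
  split_ifs <;> simp_all

theorem flipBit_comm {V : Type*} (j k : V) (z : V → Bool) :
    flipBit j (flipBit k z) = flipBit k (flipBit j z) := by
  ext x
  grind [flipBit_apply]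

theorem flipBit_eq_iff {V : Type*} {j : V} {z w : V → Bool} :
    flipBit j z = w ↔ z = flipBit j w := by
  constructor
  · rintro rfl; rw [flipBit_flipBit]
  · rintro rfl; rw [flipBit_flipBit]

theorem pauliX_apply (j : V) (z w : V → Bool) :
    pauliX j z w = if w = flipBit j z then 1 else 0 := rfl

theorem pauliX_mul_apply (j : V) (A : Operator V) (z w : V → Bool) :
    (pauliX j * A) z w = A (flipBit j z) w := by
  simp [Matrix.mul_apply, pauliX_apply]

theorem mul_pauliX_apply (j : V) (A : Operator V) (z w : V → Bool) :
    (A * pauliX j) z w = A z (flipBit j w) := by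
  have h (x : V → Bool) : w = flipBit j x ↔ x = flipBit j w := by
    rw [eq_comm, flipBit_eq_iff]
  simp [Matrix.mul_apply, pauliX_apply, h]

theorem pauliX_commute (j k : V) : Commute (pauliX j) (pauliX k) := by
  ext z w
  simp only [mul_pauliX_apply, pauliX_apply, flipBit_eq_iff, flipBit_comm j k]

theorem pauliX_commute_pauliZ {j k : V} (h : j ≠ k) : Commute (pauliX j) (pauliZ k) := by
  ext z w
  simp only [pauliX_mul_apply, mul_pauliX_apply, pauliZ, Matrix.diagonal_apply, flipBit_eq_iff,
    flipBit_apply, h.symm, if_false]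

theorem pauliX_isHermitian (j : V) : (pauliX j).IsHermitian := by
  ext z w
  simp [pauliX_apply, Matrix.conjTranspose_apply, eq_comm (a := z), flipBit_eq_iff]

theorem clauseOp_mk (j k : V) :
    clauseOp s(j, k) = (1 / 2 : ℂ) • (1 - pauliZ j * pauliZ k) := rfl

theorem clauseOp_commute_of_forall {A : Operator V} {e : Sym2 V}
    (h : ∀ j ∈ e, Commute (pauliZ j) A) : Commute (clauseOp e) A := by
  induction e with | _ j k
  have h1 : Commute (1 - pauliZ j * pauliZ k) A := (Commute.one_left A).sub_left
    ((h j (Sym2.mem_mk_left j k)).mul_left (h k (Sym2.mem_mk_right j k)))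
  rw [clauseOp_mk]
  exact h1.smul_left (1 / 2 : ℂ)

theorem clauseOp_commute (e f : Sym2 V) : Commute (clauseOp e) (clauseOp f) :=
  clauseOp_commute_of_forall fun j _ =>
    (clauseOp_commute_of_forall fun k _ => pauliZ_commute k j).symm

theorem clauseOp_commute_pauliX {e : Sym2 V} {j : V} (h : j ∉ e) :
    Commute (clauseOp e) (pauliX j) :=
  clauseOp_commute_of_forall fun k hk => (pauliX_commute_pauliZ (by rintro rfl; exact h hk)).symm

theorem clauseOp_commute_pauliZ (e : Sym2 V) (j : V) : Commute (clauseOp e) (pauliZ j) :=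
  clauseOp_commute_of_forall fun k _ => pauliZ_commute k j

/-- The clauses are diagonal with entries `0` and `1`. -/
theorem clauseOp_eq_diagonal (e : Sym2 V) :
    ∃ c : (V → Bool) → ℝ, (∀ z, 0 ≤ c z ∧ c z ≤ 1) ∧
      clauseOp e = Matrix.diagonal fun z => (c z : ℂ) := by
  induction e with | _ j k
  refine ⟨fun z => if z j = z k then 0 else 1, fun z => by dsimp only; split_ifs <;> norm_num, ?_⟩
  rw [clauseOp_mk, pauliZ, pauliZ, Matrix.diagonal_mul_diagonal, ← Matrix.diagonal_one,
    Matrix.diagonal_sub, ← Matrix.diagonal_smul]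
  congr 1
  ext z
  cases hj : z j <;> cases hk : z k <;> simp [hj, hk] <;> norm_num

theorem clauseOp_isHermitian (e : Sym2 V) : (clauseOp e).IsHermitian := by
  obtain ⟨c, -, hc⟩ := clauseOp_eq_diagonal e
  rw [hc, Matrix.IsHermitian, Matrix.diagonal_conjTranspose]
  congr 1
  ext z
  simp

theorem isHermitian_sum {V ι : Type*} (s : Finset ι) {A : ι → Operator V}
    (h : ∀ i ∈ s, (A i).IsHermitian) : (∑ i ∈ s, A i).IsHermitian := by
  rw [Matrix.IsHermitian, Matrix.conjTranspose_sum]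
  exact Finset.sum_congr rfl h

theorem costOp_isHermitian (G : SimpleGraph V) : (costOp G).IsHermitian :=
  isHermitian_sum _ fun e _ => clauseOp_isHermitian e

theorem mixerOp_isHermitian : (mixerOp V).IsHermitian :=
  isHermitian_sum _ fun j _ => pauliX_isHermitian j

/-- One layer of the circuit in the Heisenberg picture. -/
def layer (G : SimpleGraph V) (γ β : ℝ) (O : Operator V) : Operator V :=
  evolve γ (costOp G) (evolve β (mixerOp V) O)

/-- Passing to adjoints reverses the order: the mixer, applied last to the state, conjugates the
observable first. -/
theorem expectation_state_succ (G : SimpleGraph V) {p : ℕ} (γ β : Fin (p + 1) → ℝ)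
    (O : Operator V) :
    expectation O (state G (p + 1) γ β) =
      expectation (layer G (γ (Fin.last p)) (β (Fin.last p)) O)
        (state G p (fun i => γ i.castSucc) (fun i => β i.castSucc)) := by
  rw [layer, ← expectation_unitaryExp_mulVec (costOp_isHermitian G),
    ← expectation_unitaryExp_mulVec mixerOp_isHermitian]
  rfl

theorem expectation_sum {ι : Type*} (s : Finset ι) (A : ι → Operator V) (ψ : (V → Bool) → ℂ) :
    expectation (∑ i ∈ s, A i) ψ = ∑ i ∈ s, expectation (A i) ψ := by
  simp only [expectation, Matrix.sum_mulVec, dotProduct_sum, Complex.re_sum]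

theorem objective_eq_sum (G : SimpleGraph V) {p : ℕ} (γ β : Fin p → ℝ) :
    objective G γ β = ∑ e ∈ G.edgeFinset, edgeTerm G e γ β :=
  expectation_sum ..

theorem layer_one (G : SimpleGraph V) (γ β : ℝ) : layer G γ β 1 = 1 := by
  simp [layer, evolve, unitaryExp_neg_mul_self]

theorem expectation_one_uniformState : expectation (1 : Operator V) (uniformState V) = 1 := by
  have h : (Real.sqrt (2 ^ Fintype.card V) : ℂ) * Real.sqrt (2 ^ Fintype.card V) =
      2 ^ Fintype.card V := by
    rw [← Complex.ofReal_mul, Real.mul_self_sqrt (by positivity)]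
    simp
  simp [expectation, uniformState, dotProduct, ← mul_inv, h]

theorem expectation_one_state (G : SimpleGraph V) :
    ∀ {p : ℕ} (γ β : Fin p → ℝ), expectation (1 : Operator V) (state G p γ β) = 1
  | 0, _, _ => expectation_one_uniformState
  | p + 1, γ, β => by
    rw [expectation_state_succ, layer_one, expectation_one_state]

/-- A diagonal observable averages its entries with weights `normSq (ψ z)`, which sum to 1 by
`expectation_one_state`. -/
theorem edgeTerm_mem_Icc (G : SimpleGraph V) (e : Sym2 V) {p : ℕ} (γ β : Fin p → ℝ) :
    0 ≤ edgeTerm G e γ β ∧ edgeTerm G e γ β ≤ 1 := by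
  obtain ⟨c, hc, he⟩ := clauseOp_eq_diagonal e
  have h1 := expectation_one_state G γ β
  set ψ := state G p γ β
  have key (d : (V → Bool) → ℝ) : expectation (Matrix.diagonal fun z => (d z : ℂ)) ψ =
      ∑ z, d z * Complex.normSq (ψ z) := by
    simp only [expectation, dotProduct, Matrix.mulVec_diagonal, Complex.re_sum]
    refine Finset.sum_congr rfl fun z _ => ?_
    simp [Complex.normSq_apply]
    ring
  have h2 := key 1
  simp only [Pi.one_apply, Complex.ofReal_one, Matrix.diagonal_one, h1, one_mul] at h2
  rw [edgeTerm, he, key]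
  refine ⟨Finset.sum_nonneg fun z _ => mul_nonneg (hc z).1 (Complex.normSq_nonneg _), ?_⟩
  rw [h2]
  exact Finset.sum_le_sum fun z _ => mul_le_of_le_one_left (Complex.normSq_nonneg _) (hc z).2

end Pauli

/-! ### Extending operators along an embedding of qubits -/

section Extend

open NormedSpace

variable {S V : Type*}

/-- Split a bit string on `V` into its restriction along `ι` and the remaining bits. -/
def splitEquiv (ι : S ↪ V) :
    (V → Bool) ≃ (S → Bool) × ({v // v ∉ Set.range ι} → Bool) where
  toFun z := (z ∘ ι, fun v => z v)
  invFun q v := if h : v ∈ Set.range ι then q.1 h.choose else q.2 ⟨v, h⟩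
  left_inv z := by
    ext v
    dsimp only
    split_ifs with h
    · exact congrArg z h.choose_spec
    · rfl
  right_inv q := by
    refine Prod.ext (funext fun x => ?_) (funext fun v => ?_)
    · have h : ι x ∈ Set.range ι := ⟨x, rfl⟩
      simp only [Function.comp_apply, dif_pos h]
      exact congrArg q.1 (ι.injective h.choose_spec)
    · simp only [dif_neg v.2]

theorem splitEquiv_snd (ι : S ↪ V) (z : V → Bool) :
    (splitEquiv ι z).2 = fun v => z v.1 := rfl

variable [Fintype S] [Fintype V]

open scoped Kronecker in
/-- The operator on the qubits `V` that acts as `A` on the qubits `ι x` and trivially on the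
others. -/
def extend (ι : S ↪ V) : Operator S →ₐ[ℂ] Operator V :=
  AlgHom.ofLinearMap
    { toFun := fun A => (A ⊗ₖ (1 : Matrix ({v // v ∉ Set.range ι} → Bool) _ ℂ)).submatrix
        (splitEquiv ι) (splitEquiv ι)
      map_add' := fun A B => by rw [Matrix.add_kronecker, Matrix.submatrix_add]; rfl
      map_smul' := fun c A => by rw [Matrix.smul_kronecker, Matrix.submatrix_smul]; rfl }
    (by simp)
    (fun A B => by
      simp only [LinearMap.coe_mk, AddHom.coe_mk]
      rw [Matrix.submatrix_mul_equiv, ← Matrix.mul_kronecker_mul, one_mul])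

theorem extend_apply (ι : S ↪ V) (A : Operator S) (z w : V → Bool) :
    extend ι A z w = A (z ∘ ι) (w ∘ ι) *
      if ∀ v ∉ Set.range ι, z v = w v then 1 else 0 := by
  have h : (splitEquiv ι z).2 = (splitEquiv ι w).2 ↔ ∀ v ∉ Set.range ι, z v = w v := by
    simp only [splitEquiv_snd, funext_iff, Subtype.forall]
  simp only [← h]
  rfl

-- A linear map between finite-dimensional spaces is continuous, so an algebra homomorphism passes
-- through the exponential series.
open scoped Matrix.Norms.Operator in
theorem extend_exp (ι : S ↪ V) (A : Operator S) : extend ι (exp A) = exp (extend ι A) :=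
  map_exp (extend ι) (LinearMap.continuous_of_finiteDimensional (extend ι).toLinearMap) A

theorem extend_unitaryExp (ι : S ↪ V) (θ : ℝ) (A : Operator S) :
    extend ι (unitaryExp θ A) = unitaryExp θ (extend ι A) := by
  rw [unitaryExp, extend_exp, map_smul, unitaryExp]

theorem extend_evolve (ι : S ↪ V) (θ : ℝ) (A O : Operator S) :
    extend ι (evolve θ A O) = evolve θ (extend ι A) (extend ι O) := by
  simp only [evolve, map_mul, extend_unitaryExp]

theorem extend_pauliX (ι : S ↪ V) (x : S) : extend ι (pauliX x) = pauliX (ι x) := by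
  ext z w
  rw [extend_apply, pauliX_apply, pauliX_apply, mul_ite, mul_one, mul_zero, ← ite_and]
  refine if_congr ?_ rfl rfl
  rw [and_comm]
  constructor
  · rintro ⟨h1, h2⟩
    ext v
    by_cases hv : v ∈ Set.range ι
    · obtain ⟨y, rfl⟩ := hv
      simpa [flipBit_apply] using congrFun h1 y
    · have h : v ≠ ι x := by rintro rfl; exact hv ⟨x, rfl⟩
      rw [flipBit_apply, if_neg h]
      exact (h2 v hv).symm
  · rintro rfl
    refine ⟨?_, ?_⟩
    · ext y
      simp [flipBit_apply]
    · intro v hv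
      have h : v ≠ ι x := by rintro rfl; exact hv ⟨x, rfl⟩
      rw [flipBit_apply, if_neg h]

theorem extend_pauliZ (ι : S ↪ V) (x : S) : extend ι (pauliZ x) = pauliZ (ι x) := by
  ext z w
  rw [extend_apply, pauliZ, pauliZ, Matrix.diagonal_apply, Matrix.diagonal_apply]
  by_cases h : z = w
  · subst h; simp
  · have h' : ¬ (z ∘ ι = w ∘ ι ∧ ∀ v ∉ Set.range ι, z v = w v) := fun h' =>
      h ((splitEquiv ι).injective (Prod.ext h'.1 (funext fun v => h'.2 v.1 v.2)))
    grind

theorem extend_clauseOp (ι : S ↪ V) (e : Sym2 S) :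
    extend ι (clauseOp e) = clauseOp (e.map ι) := by
  induction e with | _ j k
  simp only [Sym2.map_mk, clauseOp_mk, map_smul, map_sub, map_one, map_mul, extend_pauliZ]

theorem pauliX_commute_extend (ι : S ↪ V) {v : V} (hv : v ∉ Set.range ι) (A : Operator S) :
    Commute (pauliX v) (extend ι A) := by
  have h1 (z : V → Bool) : flipBit v z ∘ ι = z ∘ ι := by
    ext x
    have h : ι x ≠ v := by rintro rfl; exact hv ⟨x, rfl⟩
    simp [flipBit_apply, h]
  ext z w
  rw [pauliX_mul_apply, mul_pauliX_apply, extend_apply, extend_apply, h1, h1]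
  congr 1
  refine if_congr ?_ rfl rfl
  refine forall₂_congr fun u _ => ?_
  by_cases h : u = v
  · simp only [flipBit_apply, h, if_true]
    cases z v <;> cases w v <;> simp
  · simp [flipBit_apply, h]

theorem pauliZ_commute_extend (ι : S ↪ V) {v : V} (hv : v ∉ Set.range ι) (A : Operator S) :
    Commute (pauliZ v) (extend ι A) := by
  ext z w
  rw [pauliZ, Matrix.diagonal_mul, Matrix.mul_diagonal, extend_apply]
  by_cases h : ∀ v ∉ Set.range ι, z v = w v
  · rw [h v hv, mul_comm]
  · rw [if_neg h, mul_zero, mul_zero, zero_mul]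

theorem expectation_uniformState (A : Operator V) :
    expectation A (uniformState V) = ((∑ z, ∑ w, A z w) / Fintype.card (V → Bool)).re := by
  have h : ((Real.sqrt (2 ^ Fintype.card V) : ℂ))⁻¹ * (Real.sqrt (2 ^ Fintype.card V) : ℂ)⁻¹ =
      ((2 : ℂ) ^ Fintype.card V)⁻¹ := by
    rw [← mul_inv, ← Complex.ofReal_mul, Real.mul_self_sqrt (by positivity)]
    simp
  rw [expectation]
  congr 1
  simp only [dotProduct, Matrix.mulVec, uniformState, Pi.star_apply, ← Finset.sum_mul,
    ← Finset.mul_sum]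
  simp only [one_div, star_inv₀, Complex.star_def, Complex.conj_ofReal, Fintype.card_fun,
    Fintype.card_bool, Nat.cast_pow, Nat.cast_ofNat]
  rw [div_eq_mul_inv, ← h]
  ring

/-- Summing the entries of the identity on the idle qubits gives the number of their bit strings,
which cancels against the larger normalization. -/
theorem expectation_extend_uniformState (ι : S ↪ V) (A : Operator S) :
    expectation (extend ι A) (uniformState V) = expectation A (uniformState S) := by
  rw [expectation_uniformState, expectation_uniformState, Fintype.card_congr (splitEquiv ι),
    Fintype.card_prod]
  congr 1
  have h : ∑ z, ∑ w, extend ι A z w =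
      Fintype.card ({v // v ∉ Set.range ι} → Bool) * ∑ z, ∑ w, A z w := by
    rw [← (splitEquiv ι).symm.sum_comp]
    simp only [← (splitEquiv ι).symm.sum_comp (extend ι A _)]
    have h' (q r) : extend ι A ((splitEquiv ι).symm q) ((splitEquiv ι).symm r) =
        A q.1 r.1 * if q.2 = r.2 then 1 else 0 := by
      change A (splitEquiv ι _).1 (splitEquiv ι _).1 *
        (1 : Matrix _ _ ℂ) (splitEquiv ι _).2 (splitEquiv ι _).2 = _
      rw [Equiv.apply_symm_apply, Equiv.apply_symm_apply, Matrix.one_apply]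
    simp only [h', Fintype.sum_prod_type]
    simp [Finset.mul_sum]
  rw [h]
  push_cast
  rw [mul_comm, mul_div_mul_right]
  exact_mod_cast Fintype.card_ne_zero

end Extend

/-! ### Spread of supports and locality of edge terms -/

section Locality

variable {S V : Type*} [Fintype S] [Fintype V]

/-- `O` acts only on the qubits in `T`. -/
def SupportedOn (T : Set V) (O : Operator V) : Prop :=
  ∀ j ∉ T, Commute O (pauliX j) ∧ Commute O (pauliZ j)

theorem supportedOn_clauseOp {T : Set V} {e : Sym2 V} (h : ∀ x ∈ e, x ∈ T) :
    SupportedOn T (clauseOp e) := fun j hj =>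
  ⟨clauseOp_commute_pauliX fun hje => hj (h j hje), clauseOp_commute_pauliZ e j⟩

theorem mixerOp_eq_add (s : Finset V) :
    mixerOp V = ∑ j ∈ s, pauliX j + ∑ j ∈ sᶜ, pauliX j :=
  (Finset.sum_add_sum_compl s _).symm

theorem sum_pauliX_commute (s t : Finset V) :
    Commute (∑ j ∈ s, pauliX j) (∑ j ∈ t, pauliX j) :=
  Commute.sum_left _ _ _ fun j _ => Commute.sum_right _ _ _ fun k _ => pauliX_commute j k

theorem sum_clauseOp_commute (s t : Finset (Sym2 V)) :
    Commute (∑ e ∈ s, clauseOp e) (∑ e ∈ t, clauseOp e) :=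
  Commute.sum_left _ _ _ fun e _ => Commute.sum_right _ _ _ fun f _ => clauseOp_commute e f

/-- The mixer is a sum of one-qubit terms: those outside `T` cancel, and those inside commute with
every Pauli operator outside. -/
theorem SupportedOn.evolve_mixerOp {T : Set V} {O : Operator V} (h : SupportedOn T O) (β : ℝ) :
    SupportedOn T (evolve β (mixerOp V) O) := by
  intro j hj
  rw [mixerOp_eq_add {j | j ∈ T}, evolve_add (sum_pauliX_commute _ _)]
  · refine ⟨evolve_commute (Commute.sum_left _ _ _ fun k _ => pauliX_commute k j) (h j hj).1 _,
      evolve_commute (Commute.sum_left _ _ _ fun k hk => pauliX_commute_pauliZ ?_) (h j hj).2 _⟩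
    rintro rfl
    exact hj (by simpa using hk)
  · exact Commute.sum_left _ _ _ fun k hk => (h k (by simpa using hk)).1.symm

/-- Clauses that miss `T` cancel; a clause that meets `T` has both ends in `T'`. -/
theorem SupportedOn.evolve_costOp {G : SimpleGraph V} {T T' : Set V} {O : Operator V}
    (h : SupportedOn T O) (hT : T ⊆ T') (hadj : ∀ x ∈ T, ∀ y, G.Adj x y → y ∈ T') (γ : ℝ) :
    SupportedOn T' (evolve γ (costOp G) O) := by
  intro j hj
  rw [costOp, ← Finset.sum_filter_add_sum_filter_not _ (fun e => ∃ x ∈ e, x ∈ T),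
    evolve_add (sum_clauseOp_commute _ _)]
  · refine ⟨evolve_commute (Commute.sum_left _ _ _ fun e he => clauseOp_commute_pauliX ?_)
        (h j fun hjT => hj (hT hjT)).1 _,
      evolve_commute (Commute.sum_left _ _ _ fun e _ => clauseOp_commute_pauliZ e j)
        (h j fun hjT => hj (hT hjT)).2 _⟩
    obtain ⟨he, x, hx, hxT⟩ := by simpa using he
    intro hje
    by_cases hjx : j = x
    · exact hj (hT (hjx ▸ hxT))
    · rw [(Sym2.mem_and_mem_iff (Ne.symm hjx)).1 ⟨hx, hje⟩] at he
      exact hj (hadj x hxT j he)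
  · refine Commute.sum_left _ _ _ fun e he => clauseOp_commute_of_forall fun k hk => ?_
    simp only [Finset.mem_filter, not_exists, not_and] at he
    exact (h k (he.2 k hk)).2.symm

theorem SupportedOn.layer {G : SimpleGraph V} {T T' : Set V} {O : Operator V}
    (h : SupportedOn T O) (hT : T ⊆ T') (hadj : ∀ x ∈ T, ∀ y, G.Adj x y → y ∈ T') (γ β : ℝ) :
    SupportedOn T' (layer G γ β O) :=
  (h.evolve_mixerOp β).evolve_costOp hT hadj γ

theorem evolve_mixerOp_extend (ι : S ↪ V) (β : ℝ) (O : Operator S) :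
    evolve β (mixerOp V) (extend ι O) = extend ι (evolve β (mixerOp S) O) := by
  rw [extend_evolve, mixerOp_eq_add (Finset.univ.map ι), evolve_add (sum_pauliX_commute _ _)]
  · rw [Finset.sum_map, mixerOp, map_sum]
    simp only [extend_pauliX]
  · refine Commute.sum_left _ _ _ fun v hv => pauliX_commute_extend ι ?_ O
    simpa using hv

/-- By `hcov`, an edge of `G` that is not the image of an edge of `N` has no end in `ι '' T`, so its
clause commutes with the observable and cancels. In particular `N` need not be induced: extra edges
of `G` between outer vertices do no harm. -/
theorem evolve_costOp_extend (ι : S ↪ V) {N : SimpleGraph S} {G : SimpleGraph V} {T : Set S}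
    {O : Operator S} (h : SupportedOn T O) (hhom : ∀ x y, N.Adj x y → G.Adj (ι x) (ι y))
    (hcov : ∀ x ∈ T, ∀ v, G.Adj (ι x) v → ∃ y, ι y = v ∧ N.Adj x y) (γ : ℝ) :
    evolve γ (costOp G) (extend ι O) = extend ι (evolve γ (costOp N) O) := by
  have hsub : N.edgeFinset.map ι.sym2Map ⊆ G.edgeFinset := by
    intro e he
    obtain ⟨f, hf, rfl⟩ := Finset.mem_map.1 he
    induction f with | _ x y
    simpa using hhom x y (by simpa using hf)
  rw [extend_evolve, costOp, ← Finset.sum_sdiff hsub, add_comm,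
    evolve_add (sum_clauseOp_commute _ _)]
  · rw [Finset.sum_map, costOp, map_sum]
    simp only [extend_clauseOp]
    rfl
  · refine Commute.sum_left _ _ _ fun e he => clauseOp_commute_of_forall fun v hv => ?_
    obtain ⟨he, hne⟩ := Finset.mem_sdiff.1 he
    by_cases hr : v ∈ Set.range ι
    · obtain ⟨x, rfl⟩ := hr
      rw [← extend_pauliZ]
      by_cases hx : x ∈ T
      · exfalso
        obtain ⟨u, rfl⟩ := hv
        obtain ⟨y, rfl, hy⟩ := hcov x hx u (by simpa using he)
        exact hne (Finset.mem_map.2 ⟨s(x, y), by simpa using hy, rfl⟩)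
      · exact ((h x hx).2.symm).map (extend ι)
    · exact pauliZ_commute_extend ι hr O

/-- Observables supported at depth `k` only see the covered part of `G`. -/
theorem expectation_extend_state (ι : S ↪ V) {N : SimpleGraph S} {G : SimpleGraph V} {q : ℕ}
    (T : ℕ → Set S) (hT : ∀ k, T k ⊆ T (k + 1))
    (hadj : ∀ k, ∀ x ∈ T k, ∀ y, N.Adj x y → y ∈ T (k + 1))
    (hhom : ∀ x y, N.Adj x y → G.Adj (ι x) (ι y))
    (hcov : ∀ k < q, ∀ x ∈ T k, ∀ v, G.Adj (ι x) v → ∃ y, ι y = v ∧ N.Adj x y) :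
    ∀ {p : ℕ} (γ β : Fin p → ℝ) {k : ℕ} {O : Operator S}, SupportedOn (T k) O → k + p ≤ q →
      expectation (extend ι O) (state G p γ β) = expectation O (state N p γ β)
  | 0, _, _, _, O, _, _ => expectation_extend_uniformState ι O
  | p + 1, γ, β, k, O, hO, hk => by
    -- Each layer is traded for one step of support: `k + (p + 1) ≤ q` becomes `(k + 1) + p ≤ q`.
    rw [expectation_state_succ, expectation_state_succ,
      ← expectation_extend_state ι T hT hadj hhom hcov _ _ (hO.layer (hT k) (hadj k) _ _)
        (by omega)]
    congr 1
    rw [layer, layer, evolve_mixerOp_extend,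
      evolve_costOp_extend ι (hO.evolve_mixerOp _) hhom (hcov k (by omega))]

theorem edgeTerm_map (ι : S ↪ V) {N : SimpleGraph S} {G : SimpleGraph V} {p : ℕ}
    (T : ℕ → Set S) (hT : ∀ k, T k ⊆ T (k + 1))
    (hadj : ∀ k, ∀ x ∈ T k, ∀ y, N.Adj x y → y ∈ T (k + 1))
    (hhom : ∀ x y, N.Adj x y → G.Adj (ι x) (ι y))
    (hcov : ∀ k < p, ∀ x ∈ T k, ∀ v, G.Adj (ι x) v → ∃ y, ι y = v ∧ N.Adj x y)
    {e : Sym2 S} (he : ∀ x ∈ e, x ∈ T 0) (γ β : Fin p → ℝ) :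
    edgeTerm G (e.map ι) γ β = edgeTerm N e γ β := by
  rw [edgeTerm, edgeTerm, ← extend_clauseOp]
  exact expectation_extend_state ι T hT hadj hhom hcov γ β (supportedOn_clauseOp he) (by omega)

theorem edgeTerm_iso {G : SimpleGraph V} {N : SimpleGraph S} (φ : N ≃g G) (e : Sym2 S) {p : ℕ}
    (γ β : Fin p → ℝ) : edgeTerm G (e.map φ) γ β = edgeTerm N e γ β :=
  edgeTerm_map φ.toEquiv.toEmbedding (fun _ => Set.univ) (fun _ => subset_rfl)
    (fun _ _ _ _ _ => trivial) (fun _ _ h => φ.map_adj_iff.2 h)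
    (fun _ _ x _ v h => ⟨φ.symm v, φ.apply_symm_apply v,
      by rw [← φ.map_adj_iff, φ.apply_symm_apply]; exact h⟩) (fun _ _ => trivial) γ β

theorem mem_iff_val_mem_of_map_eq {X : Type*} {P : Set X} {g : Sym2 P} {f : Sym2 X}
    (h : g.map Subtype.val = f) (v : P) : v ∈ g ↔ v.1 ∈ f := by
  rw [← h, Sym2.mem_map]
  constructor
  · exact fun h => ⟨v, h, rfl⟩
  · rintro ⟨w, hw, h⟩
    exact Subtype.ext h ▸ hw

/-- The supports are the balls of radius `k` around `e`, measured in `G`. For `k < p` every edge at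
such a ball belongs to the neighborhood by definition. -/
theorem edgeTerm_edgeNbhd (G : SimpleGraph V) (p : ℕ) {e : Sym2 V}
    (e' : Sym2 (edgeNbhd G e p).verts) (he : e'.map Subtype.val = e) (γ β : Fin p → ℝ) :
    edgeTerm (edgeNbhd G e p).coe e' γ β = edgeTerm G e γ β := by
  conv_rhs => rw [← he]
  symm
  refine edgeTerm_map (Function.Embedding.subtype _)
    (fun k => {v | ∃ w ∈ e, G.edist w v.1 ≤ k}) ?_ ?_ ?_ ?_ ?_ γ β
  · rintro k v ⟨w, hw, h⟩
    exact ⟨w, hw, h.trans (by simp)⟩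
  · rintro k x ⟨w, hw, h⟩ y hxy
    have h1 : G.edist x.1 y.1 ≤ 1 :=
      (SimpleGraph.edist_eq_one_iff_adj.2 ((edgeNbhd G e p).adj_sub hxy)).le
    exact ⟨w, hw, G.edist_triangle.trans (by push_cast; gcongr)⟩
  · exact fun x y h => (edgeNbhd G e p).adj_sub h
  · rintro k hk x ⟨w, hw, h⟩ v hv
    have h2 : (edgeNbhd G e p).Adj x.1 v :=
      ⟨hv, Or.inr (Or.inl ⟨w, hw, h.trans_lt (by exact_mod_cast hk)⟩)⟩
    exact ⟨⟨v, (edgeNbhd G e p).edge_vert h2.symm⟩, rfl, h2⟩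
  · intro x hx
    exact ⟨x.1, (mem_iff_val_mem_of_map_eq he x).1 hx, by simp⟩

theorem exists_edgeNbhd_map_eq {V : Type*} (G : SimpleGraph V) (e : Sym2 V) (p : ℕ) :
    ∃ e' : Sym2 (edgeNbhd G e p).verts, e'.map Subtype.val = e := by
  induction e with | _ x y
  exact ⟨s(⟨x, x, by simp, by simp⟩, ⟨y, y, by simp, by simp⟩), rfl⟩

theorem edgeTerm_eq_of_sameNbhd {W : Type*} [Fintype W] {G : SimpleGraph V} {H : SimpleGraph W}
    {e : Sym2 V} {f : Sym2 W} {p : ℕ} (h : SameNbhd G e H f p) (γ β : Fin p → ℝ) :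
    edgeTerm G e γ β = edgeTerm H f γ β := by
  obtain ⟨φ, hφ⟩ := h
  obtain ⟨e', he⟩ := exists_edgeNbhd_map_eq G e p
  obtain ⟨f', hf⟩ := exists_edgeNbhd_map_eq H f p
  have hef : e'.map φ = f' := by
    ext v
    obtain ⟨u, rfl⟩ := φ.surjective v
    rw [mem_iff_val_mem_of_map_eq hf, ← hφ, ← mem_iff_val_mem_of_map_eq he, Sym2.mem_map]
    constructor
    · rintro ⟨w, hw, h⟩
      exact φ.injective h ▸ hw
    · exact fun h => ⟨u, h, rfl⟩
  rw [← edgeTerm_edgeNbhd G p e' he, ← edgeTerm_edgeNbhd H p f' hf, ← hef, edgeTerm_iso]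

end Locality

/-! ### The truncated universal cover and the tree term -/

section TreeNeighborhood

/-- Local injectivity keeps the image of a path free of backtracking, and in a forest such a walk is
a path. If the ends have the same image, this path is closed, hence of length 0. -/
theorem injective_of_locally_injective {A B : Type*} {G : SimpleGraph A} {T : SimpleGraph B}
    (hG : G.Preconnected) (hT : T.IsAcyclic) (f : G →g T)
    (hf : ∀ z u v, G.Adj z u → G.Adj z v → f u = f v → u = v) : Function.Injective f := by
  have key {x y : A} (w : G.Walk x y) (hw : w.edges.IsChain (· ≠ ·)) :
      (w.map f).edges.IsChain (· ≠ ·) := by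
    induction w with
    | nil => simp
    | cons h q ih =>
      cases q with
      | nil => simp
      | cons h' q =>
        simp only [SimpleGraph.Walk.edges_cons, SimpleGraph.Walk.map_cons,
          List.isChain_cons_cons] at hw ih ⊢
        refine ⟨fun he => hw.1 ?_, ih hw.2⟩
        rcases Sym2.eq_iff.1 he with ⟨h1, -⟩ | ⟨h1, -⟩
        · exact absurd h1 (f.map_adj h).ne
        · rw [hf _ _ _ h.symm h' h1, Sym2.eq_swap]
  intro x y hxy
  obtain ⟨w, hw⟩ := (hG x y).exists_isPath
  have h1 : w.edges.IsChain (· ≠ ·) := List.Pairwise.isChain hw.isTrail.edges_nodup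
  have h2 : (w.map f).IsPath := (hT.isPath_iff_isChain _).2 (key w h1)
  have h3 : (w.map f).length = 0 := by
    have h4 : ((w.map f).copy rfl hxy.symm).IsPath := by
      rwa [SimpleGraph.Walk.isPath_copy]
    rw [SimpleGraph.Walk.isPath_iff_nil, ← SimpleGraph.Walk.length_eq_zero_iff] at h4
    rwa [SimpleGraph.Walk.length_copy] at h4
  rw [SimpleGraph.Walk.length_map] at h3
  exact SimpleGraph.Walk.eq_of_length_eq_zero h3

variable {V : Type*} [Fintype V]

theorem exists_children {G : SimpleGraph V} (hG : G.IsRegularOfDegree 3) {v u : V}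
    (h : G.Adj v u) : ∃ c : Bool → V, Function.Injective c ∧ (∀ b, c b ≠ u) ∧
      ∀ w, G.Adj v w ↔ w = u ∨ ∃ b, w = c b := by
  have h1 : ((G.neighborFinset v).erase u).card = 2 := by
    rw [Finset.card_erase_of_mem (by simpa using h), G.card_neighborFinset_eq_degree, hG v]
  obtain ⟨a, b, hab, he⟩ := Finset.card_eq_two.1 h1
  have h2 (w : V) : (w ≠ u ∧ G.Adj v w) ↔ w = a ∨ w = b := by
    simpa using Finset.ext_iff.1 he w
  refine ⟨fun i => if i then a else b, ?_, ?_, fun w => ?_⟩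
  · intro i j
    cases i <;> cases j <;> simp [hab, hab.symm]
  · intro i
    cases i
    · simpa using ((h2 b).2 (Or.inr rfl)).1
    · simpa using ((h2 a).2 (Or.inl rfl)).1
  · simp only [Bool.exists_bool, if_true, Bool.false_eq_true, if_false]
    rw [or_comm (a := w = b), ← h2]
    by_cases hw : w = u
    · simp [hw, h]
    · simp [hw]

/-- The two neighbors of `v` other than `u`. -/
def children (G : SimpleGraph V) (v u : V) : Bool → V :=
  -- The `else` value is never met below: `descend_adj` keeps each vertex adjacent to its parent.
  if h : G.IsRegularOfDegree 3 ∧ G.Adj v u then (exists_children h.1 h.2).choose else fun _ => v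

theorem children_spec {G : SimpleGraph V} (hG : G.IsRegularOfDegree 3) {v u : V}
    (h : G.Adj v u) : Function.Injective (children G v u) ∧ (∀ b, children G v u b ≠ u) ∧
      ∀ w, G.Adj v w ↔ w = u ∨ ∃ b, w = children G v u b := by
  rw [children, dif_pos ⟨hG, h⟩]
  exact (exists_children hG h).choose_spec

/-- The vertex reached from `x` by descending along a path, away from `y`, and its parent. -/
def descend (G : SimpleGraph V) (x y : V) : List Bool → V × V
  | [] => (x, y)
  | b :: l => (children G (descend G x y l).1 (descend G x y l).2 b, (descend G x y l).1)

theorem descend_adj {G : SimpleGraph V} (hG : G.IsRegularOfDegree 3) {x y : V} (h : G.Adj x y) :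
    ∀ l, G.Adj (descend G x y l).1 (descend G x y l).2
  | [] => h
  | b :: l => (((children_spec hG (descend_adj hG h l)).2.2 _).2 (Or.inr ⟨b, rfl⟩)).symm

theorem edist_descend_le {G : SimpleGraph V} (hG : G.IsRegularOfDegree 3) {x y : V}
    (h : G.Adj x y) : ∀ l, G.edist x (descend G x y l).1 ≤ l.length
  | [] => by simp [descend]
  | b :: l => by
    have h1 : G.edist (descend G x y l).1 (descend G x y (b :: l)).1 ≤ 1 :=
      (SimpleGraph.edist_eq_one_iff_adj.2 (descend_adj hG h (b :: l)).symm).le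
    refine G.edist_triangle.trans ((add_le_add (edist_descend_le hG h l) h1).trans ?_)
    simp

/-- The parent of a vertex of the tree; the endpoints of the central edge are parents of each
other. -/
def treeParent {p : ℕ} : TreeVertex p → TreeVertex p
  | (s, ⟨[], h⟩) => (!s, ⟨[], h⟩)
  | (s, ⟨_ :: l, h⟩) => (s, ⟨l, (Nat.le_succ _).trans h⟩)

theorem edgeTree_adj {p : ℕ} {z w : TreeVertex p} (h : (edgeTree p).Adj z w) :
    w = treeParent z ∨ ∃ b, w.1 = z.1 ∧ w.2.1 = b :: z.2.1 := by
  obtain ⟨s, l, hl⟩ := z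
  obtain ⟨t, m, hm⟩ := w
  simp only [edgeTree, SimpleGraph.fromRel_adj] at h
  rcases h with ⟨-, (⟨h1, h2, h3⟩ | ⟨h1, b, h2⟩) | (⟨h1, h2, h3⟩ | ⟨h1, b, h2⟩)⟩
  · subst h1 h2
    left
    cases s <;> cases t <;> simp_all [treeParent]
  · exact Or.inr ⟨b, h1.symm, h2⟩
  · subst h1 h2
    left
    cases s <;> cases t <;> simp_all [treeParent]
  · subst h1 h2
    exact Or.inl rfl

theorem edgeTree_adj_treeParent {p : ℕ} (z : TreeVertex p) :
    (edgeTree p).Adj z (treeParent z) := by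
  obtain ⟨s, l, hl⟩ := z
  rw [edgeTree, SimpleGraph.fromRel_adj]
  cases l with
  | nil => cases s <;> simp [treeParent]
  | cons b l => simp [treeParent]

theorem edgeTree_adj_child {p : ℕ} (s : Bool) (b : Bool) (l : List Bool)
    (h : (b :: l).length ≤ p) :
    (edgeTree p).Adj (s, ⟨l, (Nat.le_succ _).trans h⟩) (s, ⟨b :: l, h⟩) :=
  (edgeTree_adj_treeParent (p := p) (s, ⟨b :: l, h⟩)).symm

theorem edgeTree_preconnected (p : ℕ) : (edgeTree p).Preconnected := by
  have h (s : Bool) : ∀ (l : List Bool) (hl : l.length ≤ p),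
      (edgeTree p).Reachable (s, ⟨l, hl⟩) (s, ⟨[], Nat.zero_le p⟩) := by
    intro l
    induction l with
    | nil => exact fun _ => SimpleGraph.Reachable.refl _
    | cons b l ih =>
      exact fun hl => (edgeTree_adj_child s b l hl).symm.reachable.trans (ih _)
  have h' (s : Bool) : (edgeTree p).Reachable (s, ⟨[], Nat.zero_le p⟩)
      (false, ⟨[], Nat.zero_le p⟩) := by
    cases s
    · exact SimpleGraph.Reachable.refl _
    · exact (edgeTree_adj_treeParent (p := p) (true, ⟨[], Nat.zero_le p⟩)).reachable
  intro z w
  exact ((h _ _ z.2.2).trans (h' _)).trans ((h _ _ w.2.2).trans (h' _)).symm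

/-- The map to `G` of its universal cover around the edge `xy`, truncated at depth `p`. -/
def treeCover (G : SimpleGraph V) (x y : V) {p : ℕ} (z : TreeVertex p) : V :=
  (descend G (bif z.1 then y else x) (bif z.1 then x else y) z.2.1).1

/-- The image of the parent under `treeCover`. -/
def treeCoverParent (G : SimpleGraph V) (x y : V) {p : ℕ} (z : TreeVertex p) : V :=
  (descend G (bif z.1 then y else x) (bif z.1 then x else y) z.2.1).2

variable {G : SimpleGraph V} {x y : V} {p : ℕ}

theorem treeCover_treeParent (z : TreeVertex p) :
    treeCover G x y (treeParent z) = treeCoverParent G x y z := by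
  obtain ⟨s, l, hl⟩ := z
  cases l with
  | nil => cases s <;> rfl
  | cons b l => rfl

theorem treeCover_child {z w : TreeVertex p} {b : Bool} (h1 : w.1 = z.1)
    (h2 : w.2.1 = b :: z.2.1) : treeCover G x y w =
      children G (treeCover G x y z) (treeCoverParent G x y z) b := by
  rw [treeCover, h1, h2]
  rfl

theorem treeCover_adj_parent (hG : G.IsRegularOfDegree 3) (h : G.Adj x y) (z : TreeVertex p) :
    G.Adj (treeCover G x y z) (treeCoverParent G x y z) := by
  refine descend_adj hG ?_ _
  cases z.1
  · exact h
  · exact h.symm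

theorem treeCover_adj (hG : G.IsRegularOfDegree 3) (h : G.Adj x y) {z w : TreeVertex p}
    (hzw : (edgeTree p).Adj z w) : G.Adj (treeCover G x y z) (treeCover G x y w) := by
  have hz := treeCover_adj_parent hG h z
  rcases edgeTree_adj hzw with rfl | ⟨b, h1, h2⟩
  · rwa [treeCover_treeParent]
  · rw [treeCover_child h1 h2]
    exact ((children_spec hG hz).2.2 _).2 (Or.inr ⟨b, rfl⟩)

theorem treeCover_locally_injective (hG : G.IsRegularOfDegree 3) (h : G.Adj x y)
    {z u w : TreeVertex p} (hu : (edgeTree p).Adj z u) (hw : (edgeTree p).Adj z w)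
    (huw : treeCover G x y u = treeCover G x y w) : u = w := by
  obtain ⟨hc1, hc2, -⟩ := children_spec hG (treeCover_adj_parent hG h z)
  rcases edgeTree_adj hu with rfl | ⟨b, h1, h2⟩ <;> rcases edgeTree_adj hw with rfl | ⟨c, h3, h4⟩
  · rfl
  · rw [treeCover_treeParent, treeCover_child h3 h4] at huw
    exact absurd huw.symm (hc2 c)
  · rw [treeCover_treeParent, treeCover_child h1 h2] at huw
    exact absurd huw (hc2 b)
  · rw [treeCover_child h1 h2, treeCover_child h3 h4] at huw
    rw [hc1 huw, ← h4] at h2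
    exact Prod.ext (h1.trans h3.symm) (Subtype.ext h2)

theorem treeCover_locally_surjective (hG : G.IsRegularOfDegree 3) (h : G.Adj x y)
    {z : TreeVertex p} (hz : z.2.1.length < p) {v : V} (hv : G.Adj (treeCover G x y z) v) :
    ∃ w, treeCover G x y w = v ∧ (edgeTree p).Adj z w := by
  rcases ((children_spec hG (treeCover_adj_parent hG h z)).2.2 _).1 hv with rfl | ⟨b, rfl⟩
  · exact ⟨treeParent z, treeCover_treeParent z, edgeTree_adj_treeParent z⟩
  · exact ⟨(z.1, ⟨b :: z.2.1, hz⟩), treeCover_child rfl rfl, edgeTree_adj_child _ _ _ hz⟩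

theorem exists_edist_treeCover_le (hG : G.IsRegularOfDegree 3) (h : G.Adj x y)
    (z : TreeVertex p) :
    ∃ w ∈ s(x, y), G.edist w (treeCover G x y z) ≤ z.2.1.length := by
  refine ⟨bif z.1 then y else x, by cases z.1 <;> simp, edist_descend_le hG ?_ _⟩
  cases z.1
  · exact h
  · exact h.symm

theorem treeCover_edgeNbhd_adj (hG : G.IsRegularOfDegree 3) (h : G.Adj x y)
    {z w : TreeVertex p} (hzw : (edgeTree p).Adj z w) :
    (edgeNbhd G s(x, y) p).Adj (treeCover G x y z) (treeCover G x y w) := by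
  refine ⟨treeCover_adj hG h hzw, ?_⟩
  have key (z : TreeVertex p) (hz : z.2.1.length < p) :
      ∃ v ∈ s(x, y), G.edist v (treeCover G x y z) < p := by
    obtain ⟨v, hv, hd⟩ := exists_edist_treeCover_le hG h z
    exact ⟨v, hv, hd.trans_lt (by exact_mod_cast hz)⟩
  rcases edgeTree_adj hzw with rfl | ⟨b, h1, h2⟩
  · obtain ⟨s, l, hl⟩ := z
    cases l with
    | nil =>
      left
      cases s
      · rfl
      · exact Sym2.eq_swap
    | cons b l => exact Or.inr (Or.inr (key _ hl))
  · refine Or.inr (Or.inl (key _ ?_))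
    have := w.2.2
    rw [h2] at this
    exact this

/-- The cover is first corestricted to the neighborhood, since `G` itself may have cycles. -/
theorem treeCover_injective (hG : G.IsRegularOfDegree 3) (h : G.Adj x y)
    (ht : IsTreeLike G s(x, y) p) :
    Function.Injective (treeCover G x y : TreeVertex p → V) := by
  let f : edgeTree p →g (edgeNbhd G s(x, y) p).coe :=
    { toFun := fun z => ⟨treeCover G x y z,
        (edgeNbhd G s(x, y) p).edge_vert (treeCover_edgeNbhd_adj hG h (edgeTree_adj_treeParent z))⟩
      map_rel' := fun hzw => treeCover_edgeNbhd_adj hG h hzw }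
  have hf : Function.Injective f :=
    injective_of_locally_injective (edgeTree_preconnected p) ht.isAcyclic f
      fun z u v hu hv huv => treeCover_locally_injective hG h hu hv (congrArg Subtype.val huv)
  exact fun z w hzw => hf (Subtype.ext hzw)

/-- The tree embeds directly in `G`, with supports given by depth; no isomorphism with the
neighborhood is needed, only local surjectivity at depth less than `p`. -/
theorem edgeTerm_eq_treeTerm (hG : G.IsRegularOfDegree 3) {e : Sym2 V} (he : e ∈ G.edgeSet)
    (ht : IsTreeLike G e p) (γ β : Fin p → ℝ) : edgeTerm G e γ β = treeTerm γ β := by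
  induction e with | _ x y
  refine edgeTerm_map ⟨treeCover G x y, treeCover_injective hG he ht⟩
    (fun k => {z : TreeVertex p | z.2.1.length ≤ k}) (fun k z hz => Nat.le_succ_of_le hz) ?_
    (fun z w hzw => treeCover_adj hG he hzw)
    (fun k hk z hz v hv => treeCover_locally_surjective hG he (lt_of_le_of_lt hz hk) hv)
    (e := centralEdge p) ?_ γ β
  · intro k z hz w hzw
    rcases edgeTree_adj hzw with rfl | ⟨b, h1, h2⟩
    · obtain ⟨s, l, hl⟩ := z
      cases l with
      | nil => exact Nat.zero_le _
      | cons b l => exact (Nat.le_succ _).trans (hz.trans (Nat.le_succ _))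
    · change w.2.1.length ≤ k + 1
      rw [h2]
      exact Nat.succ_le_succ hz
  · intro z hz
    rcases Sym2.mem_iff.1 hz with rfl | rfl <;> exact le_refl (0 : ℕ)

theorem card_edgeFinset_of_cubic (hG : G.IsRegularOfDegree 3) :
    2 * #G.edgeFinset = 3 * Fintype.card V := by
  rw [← G.sum_degrees_eq_twice_card_edges, Finset.sum_congr rfl fun v _ => hG v]
  simp [mul_comm]

theorem abs_objectivePerEdge_sub_treeTerm_le [Nonempty V] (hG : G.IsRegularOfDegree 3)
    (γ β : Fin p → ℝ) :
    |objectivePerEdge G γ β - treeTerm γ β| ≤ nonTreeFraction G p := by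
  have hm : (0 : ℝ) < #G.edgeFinset := by
    have := card_edgeFinset_of_cubic hG
    have := Fintype.card_pos (α := V)
    exact_mod_cast (by omega : 0 < #G.edgeFinset)
  have ht := edgeTerm_mem_Icc (edgeTree p) (centralEdge p) γ β
  have h1 : objectivePerEdge G γ β - treeTerm γ β =
      (∑ e ∈ G.edgeFinset, (edgeTerm G e γ β - treeTerm γ β)) / #G.edgeFinset := by
    rw [objectivePerEdge, objective_eq_sum, Finset.sum_sub_distrib, Finset.sum_const,
      nsmul_eq_mul]
    field_simp
  rw [h1, abs_div, abs_of_pos hm, nonTreeFraction]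
  gcongr
  refine (Finset.abs_sum_le_sum_abs _ _).trans ?_
  rw [Finset.card_filter, Nat.cast_sum]
  refine Finset.sum_le_sum fun e he => ?_
  have he' := edgeTerm_mem_Icc G e γ β
  split_ifs with h
  · rw [edgeTerm_eq_treeTerm hG (by simpa using he) h, sub_self]
    simp
  · rw [treeTerm, abs_le]
    push_cast
    constructor <;> linarith [he'.1, he'.2, ht.1, ht.2]

end TreeNeighborhood

/-! ### Non-tree neighborhoods come from short cycles -/

section ShortCycles

variable {V : Type*} {G : SimpleGraph V}

theorem exists_walk_length_le_of_edist_le {x v : V} {r : ℕ} (h : G.edist x v ≤ r) :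
    ∃ q : G.Walk x v, q.length ≤ r := by
  have hr : G.Reachable x v :=
    SimpleGraph.reachable_of_edist_ne_top fun ht => by simp [ht] at h
  obtain ⟨q, hq⟩ := hr.exists_walk_length_eq_edist
  exact ⟨q, by rw [← hq] at h; exact_mod_cast h⟩

theorem edist_le_succ_iff {x v : V} {r : ℕ} :
    G.edist x v ≤ (r + 1 : ℕ) ↔ G.edist x v ≤ r ∨ ∃ u, G.edist x u ≤ r ∧ G.Adj u v := by
  constructor
  · intro h
    obtain ⟨q, hq⟩ := exists_walk_length_le_of_edist_le h
    -- Reversal exposes the last edge of the walk to case analysis.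
    generalize hq' : q.reverse = q'
    have hl : q'.length ≤ r + 1 := by rw [← hq', SimpleGraph.Walk.length_reverse]; exact hq
    cases q' with
    | nil => left; simp
    | cons ha q'' =>
      refine Or.inr ⟨_, ?_, ha.symm⟩
      rw [SimpleGraph.Walk.length_cons] at hl
      exact q''.reverse.edist_le.trans (by
        rw [SimpleGraph.Walk.length_reverse]; exact_mod_cast Nat.le_of_succ_le_succ hl)
  · rintro (h | ⟨u, h, ha⟩)
    · exact h.trans (by exact_mod_cast Nat.le_succ r)
    · refine G.edist_triangle.trans ((add_le_add h
        (SimpleGraph.edist_eq_one_iff_adj.2 ha).le).trans ?_)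
      simp

/-- The edge `xy` lies on a closed walk of length at most `L + 1` that traverses it once. -/
def IsShortCycleEdge (G : SimpleGraph V) (L : ℕ) (x y : V) : Prop :=
  G.Adj x y ∧ ∃ q : G.Walk x y, s(x, y) ∉ q.edges ∧ q.length ≤ L

/-- Geodesics from an end of `e` stay in the neighborhood, so it can fail to be a tree only by
containing a cycle. -/
theorem edgeNbhd_connected {e : Sym2 V} (he : e ∈ G.edgeSet) (p : ℕ) :
    (edgeNbhd G e p).coe.Connected := by
  have hmem {w : V} (hw : w ∈ e) : w ∈ (edgeNbhd G e p).verts := ⟨w, hw, by simp⟩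
  have hadj {u v : V} (h : (edgeNbhd G e p).Adj u v) : (edgeNbhd G e p).coe.Reachable
      ⟨u, (edgeNbhd G e p).edge_vert h⟩ ⟨v, (edgeNbhd G e p).edge_vert h.symm⟩ := by
    have h' : (edgeNbhd G e p).coe.Adj ⟨u, (edgeNbhd G e p).edge_vert h⟩
      ⟨v, (edgeNbhd G e p).edge_vert h.symm⟩ := h
    exact h'.reachable
  have key : ∀ k ≤ p, ∀ (w : V) (hw : w ∈ e) (v : V) (hv : v ∈ (edgeNbhd G e p).verts),
      G.edist w v ≤ k → (edgeNbhd G e p).coe.Reachable ⟨w, hmem hw⟩ ⟨v, hv⟩ := by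
    intro k
    induction k with
    | zero =>
      intro _ w hw v hv h
      obtain rfl : w = v := by simpa using h
      exact SimpleGraph.Reachable.refl _
    | succ k ih =>
      intro hk w hw v hv h
      rcases edist_le_succ_iff.1 h with h | ⟨u, hu, ha⟩
      · exact ih (by omega) w hw v hv h
      · have ha' : (edgeNbhd G e p).Adj u v :=
          ⟨ha, Or.inr (Or.inl ⟨w, hw, hu.trans_lt (by exact_mod_cast hk)⟩)⟩
        have hu' := (edgeNbhd G e p).edge_vert ha'
        exact (ih (by omega) w hw u hu' hu).trans (hadj ha')
  induction e with | _ x y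
  have hxy : (edgeNbhd G s(x, y) p).coe.Reachable ⟨x, hmem (by simp)⟩ ⟨y, hmem (by simp)⟩ :=
    hadj ⟨he, Or.inl rfl⟩
  have hx (v : (edgeNbhd G s(x, y) p).verts) :
      (edgeNbhd G s(x, y) p).coe.Reachable ⟨x, hmem (by simp)⟩ v := by
    obtain ⟨v, hv⟩ := v
    obtain ⟨w, hw, h⟩ := hv
    have h1 := key p le_rfl w hw v ⟨w, hw, h⟩ h
    rcases Sym2.mem_iff.1 hw with rfl | rfl
    · exact h1
    · exact hxy.trans h1
  have : Nonempty (edgeNbhd G s(x, y) p).verts := ⟨⟨x, hmem (by simp)⟩⟩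
  exact ⟨fun u v => (hx u).symm.trans (hx v)⟩

variable [Fintype V]

/-- The vertices at distance at most `r` from `x`. -/
def closedBall (G : SimpleGraph V) (x : V) (r : ℕ) : Finset V :=
  {v | G.edist x v ≤ r}

theorem mem_closedBall {x v : V} {r : ℕ} : v ∈ closedBall G x r ↔ G.edist x v ≤ r := by
  simp [closedBall]

theorem card_closedBall_le (hG : G.IsRegularOfDegree 3) (x : V) (r : ℕ) :
    #(closedBall G x r) ≤ 4 ^ r := by
  induction r with
  | zero =>
    refine Finset.card_le_one.2 fun u hu v hv => ?_
    simp only [mem_closedBall, Nat.cast_zero, nonpos_iff_eq_zero,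
      SimpleGraph.edist_eq_zero_iff] at hu hv
    exact hu.symm.trans hv
  | succ r ih =>
    have hsub : closedBall G x (r + 1) ⊆
        (closedBall G x r).biUnion fun u => insert u (G.neighborFinset u) := by
      intro v hv
      rw [Finset.mem_biUnion]
      rcases edist_le_succ_iff.1 (mem_closedBall.1 hv) with h | ⟨u, hu, ha⟩
      · exact ⟨v, mem_closedBall.2 h, Finset.mem_insert_self _ _⟩
      · exact ⟨u, mem_closedBall.2 hu, Finset.mem_insert_of_mem (by simpa using ha)⟩
    refine (Finset.card_le_card hsub).trans ((Finset.card_biUnion_le_card_mul _ _ 4 ?_).trans ?_)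
    · intro u _
      refine (Finset.card_insert_le _ _).trans ?_
      rw [G.card_neighborFinset_eq_degree, hG u]
    · rw [pow_succ]
      exact Nat.mul_le_mul_right _ ih

/-- Some edge of the neighborhood is not a bridge. A detour around it can be taken to be a path, so
it is shorter than the number of vertices, which two balls of size at most `4 ^ p` bound. -/
theorem exists_isShortCycleEdge (hG : G.IsRegularOfDegree 3) {e : Sym2 V} (he : e ∈ G.edgeSet)
    {p : ℕ} (h : ¬ IsTreeLike G e p) :
    ∃ x y, IsShortCycleEdge G (2 * 4 ^ p) x y ∧ ∃ w ∈ e, G.edist x w ≤ p := by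
  have h1 : ¬ (edgeNbhd G e p).coe.IsAcyclic := fun ha => h ⟨edgeNbhd_connected he p, ha⟩
  rw [SimpleGraph.isAcyclic_iff_forall_adj_isBridge] at h1
  push Not at h1
  obtain ⟨x, y, hxy, hb⟩ := h1
  rw [SimpleGraph.isBridge_iff_forall_walk_mem_edges] at hb
  push Not at hb
  obtain ⟨q, hq⟩ := hb
  have hcard : Fintype.card (edgeNbhd G e p).verts ≤ 2 * 4 ^ p := by
    induction e with | _ u v
    rw [← Set.toFinset_card]
    have hsub : (edgeNbhd G s(u, v) p).verts.toFinset ⊆ closedBall G u p ∪ closedBall G v p := by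
      intro z hz
      obtain ⟨w, hw, hd⟩ := Set.mem_toFinset.1 hz
      rcases Sym2.mem_iff.1 hw with rfl | rfl <;> simp [mem_closedBall, hd]
    refine (Finset.card_le_card hsub).trans ((Finset.card_union_le _ _).trans ?_)
    have := card_closedBall_le hG u p
    have := card_closedBall_le hG v p
    omega
  refine ⟨(edgeNbhd G e p).hom x, (edgeNbhd G e p).hom y,
    ⟨(edgeNbhd G e p).hom.map_adj hxy, q.bypass.map (edgeNbhd G e p).hom, ?_, ?_⟩, ?_⟩
  · rw [SimpleGraph.Walk.edges_map, List.mem_map]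
    rintro ⟨f, hf, hfe⟩
    have h2 : f = s(x, y) :=
      Sym2.map.injective (SimpleGraph.Subgraph.hom_injective (x := edgeNbhd G e p)) hfe
    exact hq (q.edges_bypass_subset_edges (h2 ▸ hf))
  · rw [SimpleGraph.Walk.length_map]
    exact (q.bypass_isPath.length_lt.trans_le hcard).le
  · obtain ⟨w, hw, hd⟩ := x.2
    exact ⟨w, hw, by rwa [SimpleGraph.edist_comm]⟩

/-- A short-cycle edge spoils only edges with an end in the `p`-ball around its first vertex: at
most `4 ^ p` vertices with three edges each. -/
theorem card_not_isTreeLike_le (hG : G.IsRegularOfDegree 3) (p : ℕ) :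
    #{e ∈ G.edgeFinset | ¬ IsTreeLike G e p} ≤
      #{q : V × V | IsShortCycleEdge G (2 * 4 ^ p) q.1 q.2} * (4 ^ p * 3) := by
  refine (Finset.card_le_card (t := ({q : V × V | IsShortCycleEdge G (2 * 4 ^ p) q.1 q.2} :
    Finset _).biUnion fun q => (closedBall G q.1 p).biUnion fun w => G.incidenceFinset w)
      ?_).trans (Finset.card_biUnion_le_card_mul _ _ _ fun q _ => ?_)
  · intro e he
    obtain ⟨he, ht⟩ := Finset.mem_filter.1 he
    obtain ⟨x, y, hxy, w, hw, hd⟩ := exists_isShortCycleEdge hG (by simpa using he) ht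
    refine Finset.mem_biUnion.2 ⟨(x, y), by simpa using hxy, Finset.mem_biUnion.2
      ⟨w, mem_closedBall.2 hd, ?_⟩⟩
    rw [SimpleGraph.mem_incidenceFinset]
    exact ⟨by simpa using he, hw⟩
  · refine (Finset.card_biUnion_le_card_mul _ _ 3 fun w _ => ?_).trans
      (Nat.mul_le_mul_right _ (card_closedBall_le hG _ _))
    rw [SimpleGraph.card_incidenceFinset_eq_degree, hG w]

end ShortCycles

/-! ### Switchings and the rarity of short cycles -/

section Switching

variable {V : Type*} {G : SimpleGraph V} {x y a b : V}

/-- Replace the edges `xy` and `ab` by `xa` and `yb`. -/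
def switch (G : SimpleGraph V) (x y a b : V) : SimpleGraph V :=
  G.deleteEdges {s(x, y), s(a, b)} ⊔ SimpleGraph.fromEdgeSet {s(x, a), s(y, b)}

theorem switch_comm (G : SimpleGraph V) (x y a b : V) : switch G x y a b = switch G y x b a := by
  simp only [switch, Sym2.eq_swap (a := x) (b := y), Sym2.eq_swap (a := a) (b := b),
    Set.pair_comm s(x, a)]

theorem switch_swap (G : SimpleGraph V) (x y a b : V) : switch G x y a b = switch G a b x y := by
  simp only [switch, Sym2.eq_swap (a := x) (b := a), Sym2.eq_swap (a := y) (b := b),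
    Set.pair_comm s(x, y)]

theorem edgeSet_switch (hxa : x ≠ a) (hyb : y ≠ b) :
    (switch G x y a b).edgeSet =
      G.edgeSet \ {s(x, y), s(a, b)} ∪ {s(x, a), s(y, b)} := by
  rw [switch, SimpleGraph.edgeSet_sup, SimpleGraph.edgeSet_deleteEdges,
    SimpleGraph.edgeSet_fromEdgeSet]
  congr 1
  ext e
  simp only [Set.mem_sdiff, Set.mem_insert_iff, Set.mem_singleton_iff, Sym2.mem_diagSet]
  constructor
  · exact fun h => h.1
  · rintro (rfl | rfl)
    · exact ⟨Or.inl rfl, by simpa using hxa⟩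
    · exact ⟨Or.inr rfl, by simpa using hyb⟩

/-- The edges `xy` and `ab` are disjoint, and `x` and `y` are not adjacent to `a` and `b`,
respectively. -/
structure Switchable (G : SimpleGraph V) (x y a b : V) : Prop where
  adj_left : G.Adj x y
  adj_right : G.Adj a b
  ne_xa : x ≠ a
  ne_xb : x ≠ b
  ne_ya : y ≠ a
  ne_yb : y ≠ b
  not_adj_xa : ¬ G.Adj x a
  not_adj_yb : ¬ G.Adj y b

theorem Switchable.comm (h : Switchable G x y a b) : Switchable G y x b a :=
  ⟨h.adj_left.symm, h.adj_right.symm, h.ne_yb, h.ne_ya, h.ne_xb, h.ne_xa, h.not_adj_yb,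
    h.not_adj_xa⟩

theorem Switchable.swap (h : Switchable G x y a b) : Switchable G a b x y :=
  ⟨h.adj_right, h.adj_left, h.ne_xa.symm, h.ne_ya.symm, h.ne_xb.symm, h.ne_yb.symm,
    fun h' => h.not_adj_xa h'.symm, fun h' => h.not_adj_yb h'.symm⟩

/-- Each way to fail gives a walk of length at most 3 from `x` to `a`. -/
theorem switchable_of_edist (hxy : G.Adj x y) (hab : G.Adj a b) (h : ¬ G.edist x a ≤ 3) :
    Switchable G x y a b := by
  have hw {q : G.Walk x a} (hq : q.length ≤ 3) : False :=
    h (q.edist_le.trans (by exact_mod_cast hq))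
  refine ⟨hxy, hab, ?_, ?_, ?_, ?_, ?_, ?_⟩
  · rintro rfl
    exact hw (q := .nil) (by simp)
  · rintro rfl
    exact hw (q := .cons hab.symm .nil) (by simp)
  · rintro rfl
    exact hw (q := .cons hxy .nil) (by simp)
  · rintro rfl
    exact hw (q := .cons hxy (.cons hab.symm .nil)) (by simp)
  · exact fun ha => hw (q := .cons ha .nil) (by simp)
  · exact fun ha => hw (q := .cons hxy (.cons ha (.cons hab.symm .nil))) (by simp)

theorem switch_switch (h : Switchable G x y a b) : switch (switch G x y a b) x a y b = G := by
  apply SimpleGraph.edgeSet_injective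
  rw [edgeSet_switch h.adj_left.ne h.adj_right.ne, edgeSet_switch h.ne_xa h.ne_yb]
  have h1 : s(x, y) ∈ G.edgeSet := h.adj_left
  have h2 : s(a, b) ∈ G.edgeSet := h.adj_right
  have h3 : s(x, a) ∉ G.edgeSet := h.not_adj_xa
  have h4 : s(y, b) ∉ G.edgeSet := h.not_adj_yb
  ext e
  simp only [Set.mem_union, Set.mem_sdiff, Set.mem_insert_iff, Set.mem_singleton_iff]
  grind

theorem switch_adj_left (h : Switchable G x y a b) (v : V) :
    (switch G x y a b).Adj x v ↔ v = a ∨ (v ≠ y ∧ G.Adj x v) := by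
  have h1 : s(x, v) ≠ s(a, b) := fun he => by
    rcases Sym2.eq_iff.1 he with ⟨h', -⟩ | ⟨h', -⟩
    exacts [h.ne_xa h', h.ne_xb h']
  have h2 : s(x, v) ≠ s(y, b) := fun he => by
    rcases Sym2.eq_iff.1 he with ⟨h', -⟩ | ⟨h', -⟩
    exacts [h.adj_left.ne h', h.ne_xb h']
  rw [← SimpleGraph.mem_edgeSet, edgeSet_switch h.ne_xa h.ne_yb]
  simp only [Set.mem_union, Set.mem_sdiff, Set.mem_insert_iff, Set.mem_singleton_iff, h1, h2,
    or_false, Sym2.congr_right, SimpleGraph.mem_edgeSet]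
  tauto

/-- The detour from `x` to `y` survives: it avoids `xy` by assumption, and it avoids `ab` because
all its vertices are within `L` of `x`, whereas `a` is not. -/
theorem edist_switch_le {L : ℕ} (hs : Switchable G x y a b) (h : IsShortCycleEdge G L x y)
    (ha : ¬ G.edist x a ≤ L) : (switch G x y a b).edist x y ≤ L := by
  obtain ⟨-, q, hq, hL⟩ := h
  have hsupp : a ∉ q.support := fun hmem =>
    ha ((q.takeUntil a hmem).edist_le.trans
      (by exact_mod_cast (q.length_takeUntil_le_length hmem).trans hL))
  have hq' : ∀ e ∈ q.edges, e ∈ (switch G x y a b).edgeSet := by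
    intro e he
    rw [edgeSet_switch hs.ne_xa hs.ne_yb]
    refine Or.inl ⟨q.edges_subset_edgeSet he, ?_⟩
    rintro (rfl | rfl)
    · exact hq he
    · exact hsupp (q.fst_mem_support_of_mem_edges he)
  refine (q.transfer _ hq').edist_le.trans ?_
  rw [SimpleGraph.Walk.length_transfer]
  exact_mod_cast hL

variable [Fintype V]

theorem switch_degree_left {d : ℕ} (h : Switchable G x y a b) (hd : G.degree x = d) :
    (switch G x y a b).degree x = d := by
  have h1 : (switch G x y a b).neighborFinset x = insert a ((G.neighborFinset x).erase y) := by
    ext v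
    simp [switch_adj_left h]
  have hy : y ∈ G.neighborFinset x := by simpa using h.adj_left
  rw [← SimpleGraph.card_neighborFinset_eq_degree, h1, Finset.card_insert_of_notMem,
    Finset.card_erase_of_mem hy, SimpleGraph.card_neighborFinset_eq_degree, hd]
  · have : 0 < d := by
      rw [← hd, ← SimpleGraph.card_neighborFinset_eq_degree]
      exact Finset.card_pos.2 ⟨y, hy⟩
    omega
  · simp [h.not_adj_xa]

theorem switch_isRegularOfDegree {d : ℕ} (h : Switchable G x y a b)
    (hG : G.IsRegularOfDegree d) : (switch G x y a b).IsRegularOfDegree d := by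
  intro v
  by_cases hx : v = x
  · subst hx; exact switch_degree_left h (hG _)
  by_cases hy : v = y
  · subst hy; rw [switch_comm]; exact switch_degree_left h.comm (hG _)
  by_cases ha : v = a
  · subst ha; rw [switch_swap]; exact switch_degree_left h.swap (hG _)
  by_cases hb : v = b
  · subst hb; rw [switch_swap, switch_comm]; exact switch_degree_left h.swap.comm (hG _)
  rw [← hG v, ← SimpleGraph.card_neighborFinset_eq_degree,
    ← SimpleGraph.card_neighborFinset_eq_degree]
  congr 1
  ext w
  have hne {c d : V} (hc : v ≠ c) (hd : v ≠ d) : s(v, w) ≠ s(c, d) := fun he => by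
    rcases Sym2.eq_iff.1 he with ⟨h', -⟩ | ⟨h', -⟩
    exacts [hc h', hd h']
  rw [SimpleGraph.mem_neighborFinset, SimpleGraph.mem_neighborFinset,
    ← SimpleGraph.mem_edgeSet, edgeSet_switch h.ne_xa h.ne_yb]
  simp [hne hx hy, hne ha hb, hne hx ha, hne hy hb]

/-- The oriented edges `ab` with `a` far from `x`. -/
def farDarts (G : SimpleGraph V) (x : V) (r : ℕ) : Finset (V × V) :=
  {q | ¬ G.edist x q.1 ≤ r ∧ G.Adj q.1 q.2}

theorem le_card_farDarts (hG : G.IsRegularOfDegree 3) (x : V) (r : ℕ) :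
    Fintype.card V ≤ #(farDarts G x r) + 4 ^ r := by
  have hsub : (closedBall G x r)ᶜ ⊆ (farDarts G x r).image Prod.fst := by
    intro a ha
    rw [Finset.mem_compl, mem_closedBall] at ha
    obtain ⟨b, hb⟩ := (G.degree_pos_iff_exists_adj a).1 (by rw [hG a]; norm_num)
    exact Finset.mem_image.2 ⟨(a, b), by simpa [farDarts] using ⟨not_le.1 ha, hb⟩, rfl⟩
  have h1 := (Finset.card_le_card hsub).trans Finset.card_image_le
  have h2 := card_closedBall_le hG x r
  rw [Finset.card_compl] at h1
  omega

/-- The oriented edges on short cycles. -/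
def shortCycleDarts (G : SimpleGraph V) (L : ℕ) : Finset (V × V) :=
  {q | IsShortCycleEdge G L q.1 q.2}

/-- The pairs of vertices at distance at most `L`. -/
def closePairs (G : SimpleGraph V) (L : ℕ) : Finset (V × V) :=
  {q | G.edist q.1 q.2 ≤ L}

theorem card_closePairs_le (hG : G.IsRegularOfDegree 3) (L : ℕ) :
    #(closePairs G L) ≤ Fintype.card V * 4 ^ L := by
  have h : #(closePairs G L) = ∑ x, #(closedBall G x L) := by
    simp only [closePairs, closedBall, Finset.card_filter, Fintype.sum_prod_type]
  rw [h]
  refine (Finset.sum_le_card_nsmul _ _ (4 ^ L) fun x _ => card_closedBall_le hG x L).trans ?_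
  simp

/-- Switching shows that short cycles are rare. -/
theorem sum_card_shortCycleDarts_mul_le (n L : ℕ) :
    (∑ G ∈ cubicGraphs n, #(shortCycleDarts G L)) * (n - 4 ^ (L + 3)) ≤
      #(cubicGraphs n) * (n * 4 ^ L * 9) := by
  have hcub {G : SimpleGraph (Fin n)} : G ∈ cubicGraphs n ↔ G.IsRegularOfDegree 3 := by
    simp [cubicGraphs]
  -- Double counting: switching injects `S` into `T`. Radius `L + 3` serves both needs, distance
  -- beyond `L` for the surviving detour and beyond 3 for switchability.
  let S := (cubicGraphs n).sigma fun G => (shortCycleDarts G L).sigma fun q =>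
    farDarts G q.1 (L + 3)
  let T := (cubicGraphs n).sigma fun G => (closePairs G L).sigma fun q =>
    G.neighborFinset q.1 ×ˢ G.neighborFinset q.2
  have hS : (∑ G ∈ cubicGraphs n, #(shortCycleDarts G L)) * (n - 4 ^ (L + 3)) ≤ #S := by
    rw [Finset.card_sigma, Finset.sum_mul]
    refine Finset.sum_le_sum fun G hG => ?_
    rw [Finset.card_sigma, ← smul_eq_mul]
    refine Finset.card_nsmul_le_sum _ _ _ fun q _ => ?_
    have := le_card_farDarts (hcub.1 hG) q.1 (L + 3)
    rw [Fintype.card_fin] at this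
    omega
  have hT : #T ≤ #(cubicGraphs n) * (n * 4 ^ L * 9) := by
    rw [Finset.card_sigma, ← smul_eq_mul]
    refine Finset.sum_le_card_nsmul _ _ _ fun G hG => ?_
    rw [Finset.card_sigma]
    have h9 (q : Fin n × Fin n) : #(G.neighborFinset q.1 ×ˢ G.neighborFinset q.2) = 9 := by
      rw [Finset.card_product, G.card_neighborFinset_eq_degree, G.card_neighborFinset_eq_degree,
        hcub.1 hG, hcub.1 hG]
    simp only [h9, Finset.sum_const, smul_eq_mul]
    have := card_closePairs_le (hcub.1 hG) L
    rw [Fintype.card_fin] at this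
    exact Nat.mul_le_mul_right _ this
  refine hS.trans (le_trans ?_ hT)
  have hsw {t : (_ : SimpleGraph (Fin n)) × (_ : Fin n × Fin n) × (Fin n × Fin n)} (ht : t ∈ S) :
      t.1.IsRegularOfDegree 3 ∧ IsShortCycleEdge t.1 L t.2.1.1 t.2.1.2 ∧
        ¬ t.1.edist t.2.1.1 t.2.2.1 ≤ L ∧
        Switchable t.1 t.2.1.1 t.2.1.2 t.2.2.1 t.2.2.2 := by
    simp only [S, Finset.mem_sigma, shortCycleDarts, farDarts, Finset.mem_filter,
      Finset.mem_univ, true_and, hcub] at ht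
    obtain ⟨h1, h2, h3, h4⟩ := ht
    refine ⟨h1, h2, fun h => h3 (h.trans ?_), switchable_of_edist h2.1 h4 fun h => h3 (h.trans ?_)⟩
    · exact_mod_cast Nat.le_add_right L 3
    · exact_mod_cast Nat.le_add_left 3 L
  refine Finset.card_le_card_of_injOn
    (fun t => ⟨switch t.1 t.2.1.1 t.2.1.2 t.2.2.1 t.2.2.2, t.2⟩) ?_ ?_
  · intro t ht
    obtain ⟨h1, h2, h3, h4⟩ := hsw ht
    simp only [T, Finset.mem_coe, Finset.mem_sigma, hcub, closePairs, Finset.mem_filter,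
      Finset.mem_univ, true_and, Finset.mem_product, SimpleGraph.mem_neighborFinset]
    refine ⟨switch_isRegularOfDegree h4 h1, edist_switch_le h4 h2 h3, ?_, ?_⟩
    · exact (switch_adj_left h4 _).2 (Or.inl rfl)
    · rw [switch_comm]
      exact (switch_adj_left h4.comm _).2 (Or.inl rfl)
  -- The four vertices are kept in the image, so the reverse switching recovers the graph.
  · intro t ht t' ht' h
    have h4 := (hsw ht).2.2.2
    have h4' := (hsw ht').2.2.2
    obtain ⟨G, q⟩ := t
    obtain ⟨G', q'⟩ := t'
    simp only [Sigma.mk.injEq, heq_eq_eq] at h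
    obtain ⟨h1, rfl⟩ := h
    obtain rfl : G = G' :=
      (switch_switch h4).symm.trans ((congrArg (fun H => switch H _ _ _ _) h1).trans
        (switch_switch h4'))
    rfl

end Switching

/-! ### Random cubic graphs: mean, Markov bound and concentration -/

section RandomCubic

variable {n : ℕ}

theorem mem_cubicGraphs {G : SimpleGraph (Fin n)} :
    G ∈ cubicGraphs n ↔ G.IsRegularOfDegree 3 := by
  simp [cubicGraphs]

/-- The witness is the circulant graph with steps `1`, `-1` and `n / 2`. Without it the
probabilities would be `0 / 0`. -/
theorem cubicGraphs_nonempty (hn : 4 ≤ n) (he : Even n) : (cubicGraphs n).Nonempty := by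
  obtain ⟨k, rfl⟩ := he
  obtain ⟨m, rfl⟩ : ∃ m, k = m + 2 := ⟨k - 2, by omega⟩
  let a : Fin (m + 2 + (m + 2)) := ⟨1, by omega⟩
  let b : Fin (m + 2 + (m + 2)) := ⟨2 * m + 3, by omega⟩
  let c : Fin (m + 2 + (m + 2)) := ⟨m + 2, by omega⟩
  have hab : a + b = 0 := by
    rw [Fin.ext_iff, Fin.val_add, Fin.val_zero]
    exact Nat.mod_eq_zero_of_dvd (dvd_of_eq (by simp only [a, b]; omega))
  have hc : c + c = 0 := by
    rw [Fin.ext_iff, Fin.val_add, Fin.val_zero]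
    exact Nat.mod_self _
  let N : Finset (Fin (m + 2 + (m + 2))) := {a, b, c}
  have hneg {x : Fin (m + 2 + (m + 2))} (hx : x ∈ N) : -x ∈ N := by
    simp only [N, Finset.mem_insert, Finset.mem_singleton] at hx ⊢
    rcases hx with rfl | rfl | rfl
    · exact Or.inr (Or.inl (neg_eq_of_add_eq_zero_right hab))
    · exact Or.inl (neg_eq_of_add_eq_zero_left hab)
    · exact Or.inr (Or.inr (neg_eq_of_add_eq_zero_right hc))
  have h0 : (0 : Fin (m + 2 + (m + 2))) ∉ N := by
    simp [N, a, b, c, Fin.ext_iff]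
  have hN : #N = 3 := by
    rw [Finset.card_eq_three]
    refine ⟨a, b, c, ?_, ?_, ?_, rfl⟩ <;> · simp only [a, b, c, Ne, Fin.mk.injEq]; omega
  let G : SimpleGraph (Fin (m + 2 + (m + 2))) :=
    { Adj := fun u v => v - u ∈ N
      symm := ⟨fun u v h => by rw [← neg_sub]; exact hneg h⟩
      loopless := ⟨fun u h => h0 (by rwa [sub_self] at h)⟩ }
  refine ⟨G, mem_cubicGraphs.2 fun u => ?_⟩
  rw [← SimpleGraph.card_neighborFinset_eq_degree, ← hN,
    ← Finset.card_map (s := N) (addLeftEmbedding u)]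
  congr 1
  ext v
  rw [SimpleGraph.mem_neighborFinset, Finset.mem_map]
  constructor
  · exact fun h => ⟨v - u, h, by simp⟩
  · rintro ⟨x, hx, rfl⟩
    simpa [G] using hx

theorem nonTreeFraction_le_one {V : Type*} [Fintype V] (G : SimpleGraph V) (p : ℕ) :
    nonTreeFraction G p ≤ 1 :=
  div_le_one_of_le₀ (by exact_mod_cast Finset.card_filter_le _ _) (Nat.cast_nonneg _)

theorem nonTreeFraction_le {G : SimpleGraph (Fin n)} (hG : G.IsRegularOfDegree 3) (p : ℕ) :
    nonTreeFraction G p ≤ 2 * 4 ^ p * #(shortCycleDarts G (2 * 4 ^ p)) / n := by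
  rcases Nat.eq_zero_or_pos n with rfl | hn
  · have : #G.edgeFinset = 0 := by simpa using card_edgeFinset_of_cubic hG
    simp [nonTreeFraction, this]
  have hm : (2 : ℝ) * #G.edgeFinset = 3 * n := by
    have := card_edgeFinset_of_cubic hG
    rw [Fintype.card_fin] at this
    exact_mod_cast this
  have hn' : (0 : ℝ) < n := by exact_mod_cast hn
  have hb : (#{e ∈ G.edgeFinset | ¬ IsTreeLike G e p} : ℝ) ≤
      #(shortCycleDarts G (2 * 4 ^ p)) * (4 ^ p * 3) := by
    exact_mod_cast card_not_isTreeLike_le hG p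
  rw [nonTreeFraction, div_le_div_iff₀ (by linarith) hn']
  calc _ ≤ (#(shortCycleDarts G (2 * 4 ^ p)) * (4 ^ p * 3) : ℝ) * n := by gcongr
    _ = 4 ^ p * #(shortCycleDarts G (2 * 4 ^ p)) * (3 * n) := by ring
    _ = _ := by rw [← hm]; ring

/-- The constant in the bound for the mean non-tree fraction. -/
def meanConst (p : ℕ) : ℝ :=
  -- The first summand covers small `n`, where the fraction is only bounded by 1; the second is the
  -- switching bound for large `n`.
  2 * 4 ^ (2 * 4 ^ p + 3) + 36 * 4 ^ p * 4 ^ (2 * 4 ^ p)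

theorem meanConst_pos (p : ℕ) : 0 < meanConst p := by
  unfold meanConst; positivity

theorem sum_nonTreeFraction_le (p : ℕ) (hn : 0 < n) :
    ∑ G ∈ cubicGraphs n, nonTreeFraction G p ≤ meanConst p / n * #(cubicGraphs n) := by
  have hn' : (0 : ℝ) < n := by exact_mod_cast hn
  set L := 2 * 4 ^ p with hL
  have hA : (0 : ℝ) ≤ 2 * 4 ^ (L + 3) := by positivity
  have hB : (0 : ℝ) ≤ 36 * 4 ^ p * 4 ^ L := by positivity
  by_cases hlarge : 2 * 4 ^ (L + 3) ≤ n
  · have h1 := sum_card_shortCycleDarts_mul_le n L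
    -- At least `n / 2` far darts remain, so short-cycle darts number at most `18 * 4 ^ L` on
    -- average.
    have h2 : n ≤ 2 * (n - 4 ^ (L + 3)) := by omega
    have h3 : (∑ G ∈ cubicGraphs n, #(shortCycleDarts G L)) ≤
        #(cubicGraphs n) * (18 * 4 ^ L) := by
      refine Nat.le_of_mul_le_mul_right ?_ hn
      calc _ ≤ (∑ G ∈ cubicGraphs n, #(shortCycleDarts G L)) * (2 * (n - 4 ^ (L + 3))) :=
            Nat.mul_le_mul_left _ h2
        _ = 2 * ((∑ G ∈ cubicGraphs n, #(shortCycleDarts G L)) * (n - 4 ^ (L + 3))) := by ring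
        _ ≤ 2 * (#(cubicGraphs n) * (n * 4 ^ L * 9)) := Nat.mul_le_mul_left _ h1
        _ = _ := by ring
    have h4 : (∑ G ∈ cubicGraphs n, (#(shortCycleDarts G L) : ℝ)) ≤
        #(cubicGraphs n) * (18 * 4 ^ L) := by exact_mod_cast h3
    calc _ ≤ ∑ G ∈ cubicGraphs n, 2 * 4 ^ p * (#(shortCycleDarts G L) : ℝ) / n :=
          Finset.sum_le_sum fun G hG => nonTreeFraction_le (mem_cubicGraphs.1 hG) p
      _ = 2 * 4 ^ p * (∑ G ∈ cubicGraphs n, (#(shortCycleDarts G L) : ℝ)) / n := by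
          rw [Finset.mul_sum, Finset.sum_div]
      _ ≤ 2 * 4 ^ p * (#(cubicGraphs n) * (18 * 4 ^ L)) / n := by gcongr
      _ = (36 * 4 ^ p * 4 ^ L) / n * #(cubicGraphs n) := by ring
      _ ≤ _ := by
          rw [meanConst, ← hL]
          gcongr
          linarith
  · have h1 : (1 : ℝ) ≤ meanConst p / n := by
      rw [le_div_iff₀ hn', one_mul, meanConst, ← hL]
      have : (n : ℝ) ≤ 2 * 4 ^ (L + 3) := by exact_mod_cast (not_le.1 hlarge).le
      linarith
    calc _ ≤ ∑ _G ∈ cubicGraphs n, (1 : ℝ) :=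
          Finset.sum_le_sum fun G _ => nonTreeFraction_le_one G p
      _ = 1 * #(cubicGraphs n) := by simp
      _ ≤ _ := by gcongr

theorem cubicMean_nonTreeFraction_le (p : ℕ) (hn : 0 < n) :
    cubicMean n (fun G => nonTreeFraction G p) ≤ meanConst p / n :=
  div_le_of_le_mul₀ (Nat.cast_nonneg _) (div_nonneg (meanConst_pos p).le (Nat.cast_nonneg _))
    (sum_nonTreeFraction_le p hn)

theorem cubicProb_mono {P Q : SimpleGraph (Fin n) → Prop}
    (h : ∀ G : SimpleGraph (Fin n), G.IsRegularOfDegree 3 → P G → Q G) :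
    cubicProb n P ≤ cubicProb n Q := by
  unfold cubicProb
  gcongr ((?_ : ℕ) : ℝ) / _
  refine Finset.card_le_card fun G hG => ?_
  obtain ⟨h1, h2⟩ := Finset.mem_filter.1 hG
  exact Finset.mem_filter.2 ⟨h1, h G (mem_cubicGraphs.1 h1) h2⟩

theorem cubicProb_le_one (P : SimpleGraph (Fin n) → Prop) : cubicProb n P ≤ 1 :=
  div_le_one_of_le₀ (by exact_mod_cast Finset.card_filter_le _ _) (Nat.cast_nonneg _)

theorem le_cubicProb_nonTreeFraction (p : ℕ) (hn : 4 ≤ n) (he : Even n) {ε : ℝ} (hε : 0 < ε) :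
    1 - ε ≤ cubicProb n (fun G => nonTreeFraction G p ≤ meanConst p / ε / n) := by
  have hn' : (0 : ℝ) < n := by exact_mod_cast (by omega : 0 < n)
  have hc : (0 : ℝ) < #(cubicGraphs n) := by
    exact_mod_cast Finset.card_pos.2 (cubicGraphs_nonempty hn he)
  have hK := meanConst_pos p
  set t : ℝ := meanConst p / ε / n
  have ht : 0 < t := by positivity
  -- Markov's inequality; `t` is the mean bound divided by `ε`.
  have h1 : #{G ∈ cubicGraphs n | ¬ nonTreeFraction G p ≤ t} * t ≤
      ∑ G ∈ cubicGraphs n, nonTreeFraction G p := by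
    rw [← nsmul_eq_mul]
    refine (Finset.card_nsmul_le_sum _ (fun G => nonTreeFraction G p) _ fun G hG => ?_).trans
      (Finset.sum_le_sum_of_subset_of_nonneg (Finset.filter_subset _ _) fun G _ _ => ?_)
    · exact (not_le.1 (Finset.mem_filter.1 hG).2).le
    · exact div_nonneg (Nat.cast_nonneg _) (Nat.cast_nonneg _)
  have h2 : meanConst p / n * #(cubicGraphs n) = (ε * #(cubicGraphs n)) * t := by
    simp only [t]; field_simp
  have h3 := le_of_mul_le_mul_right
    ((h1.trans (sum_nonTreeFraction_le p (by omega))).trans_eq h2) ht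
  have h4 : (#{G ∈ cubicGraphs n | nonTreeFraction G p ≤ t} : ℝ) +
      #{G ∈ cubicGraphs n | ¬ nonTreeFraction G p ≤ t} = #(cubicGraphs n) := by
    exact_mod_cast Finset.card_filter_add_card_filter_not (s := cubicGraphs n) _
  rw [cubicProb, le_div_iff₀ hc]
  linarith

theorem abs_sub_treeTerm_le_of_cubic {p : ℕ} {G : SimpleGraph (Fin n)} (hn : 4 ≤ n)
    (hG : G.IsRegularOfDegree 3) {t : ℝ} (h : nonTreeFraction G p ≤ t) (γ β : Fin p → ℝ) :
    |objectivePerEdge G γ β - treeTerm γ β| ≤ t := by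
  have : Nonempty (Fin n) := ⟨⟨0, by omega⟩⟩
  exact (abs_objectivePerEdge_sub_treeTerm_le hG γ β).trans h

theorem tendsto_cubicProb (p : ℕ) {δ : ℝ} (hδ : 0 < δ) :
    Tendsto (fun n => cubicProb n (fun G => ∀ γ β : Fin p → ℝ,
      |objectivePerEdge G γ β - treeTerm γ β| ≤ δ)) (atTop ⊓ 𝓟 {n : ℕ | Even n}) (𝓝 1) := by
  rw [tendsto_order]
  refine ⟨fun a ha => ?_, fun a ha => Eventually.of_forall fun n =>
    (cubicProb_le_one _).trans_lt ha⟩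
  rw [eventually_inf_principal]
  have hε : 0 < (1 - a) / 2 := by linarith
  have hlim : Tendsto (fun n : ℕ => meanConst p / ((1 - a) / 2) / n) atTop (𝓝 0) :=
    tendsto_const_div_atTop_nhds_zero_nat _
  filter_upwards [eventually_ge_atTop 4, hlim.eventually_le_const hδ] with n hn hle he
  calc a < 1 - (1 - a) / 2 := by linarith
    _ ≤ _ := le_cubicProb_nonTreeFraction p hn he hε
    _ ≤ _ := cubicProb_mono fun G hG h γ β =>
        abs_sub_treeTerm_le_of_cubic hn hG (h.trans hle) γ β

theorem cubicProb_mul_le_cubicPairProb (P : SimpleGraph (Fin n) → Prop)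
    {Q : SimpleGraph (Fin n) → SimpleGraph (Fin n) → Prop}
    (h : ∀ G H : SimpleGraph (Fin n), G.IsRegularOfDegree 3 → H.IsRegularOfDegree 3 →
      P G → P H → Q G H) : cubicProb n P * cubicProb n P ≤ cubicPairProb n Q := by
  rw [cubicProb, cubicPairProb, div_mul_div_comm, Finset.card_product, Nat.cast_mul,
    ← Nat.cast_mul, ← Finset.card_product]
  gcongr ((?_ : ℕ) : ℝ) / _
  refine Finset.card_le_card fun q hq => ?_
  obtain ⟨h1, h2⟩ := Finset.mem_product.1 hq
  obtain ⟨h1, h3⟩ := Finset.mem_filter.1 h1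
  obtain ⟨h2, h4⟩ := Finset.mem_filter.1 h2
  exact Finset.mem_filter.2 ⟨Finset.mem_product.2 ⟨h1, h2⟩,
    h _ _ (mem_cubicGraphs.1 h1) (mem_cubicGraphs.1 h2) h3 h4⟩

theorem le_cubicPairProb (p : ℕ) (hn : 4 ≤ n) (he : Even n) {ε : ℝ} (hε : 0 < ε) :
    1 - ε ≤ cubicPairProb n (fun G H => ∀ γ β : Fin p → ℝ,
      |objectivePerEdge G γ β - objectivePerEdge H γ β| ≤
        2 * (meanConst p / (ε / 2)) / n) := by
  have h1 := le_cubicProb_nonTreeFraction p hn he (half_pos hε)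
  refine le_trans ?_ (cubicProb_mul_le_cubicPairProb
    (fun G => nonTreeFraction G p ≤ meanConst p / (ε / 2) / n) fun G H hG hH hPG hPH γ β => ?_)
  -- If `P` is the single-graph probability, `P ^ 2 ≥ 2 * P - 1 ≥ 1 - ε`, whatever the sign of `1 -
  -- ε / 2`.
  · nlinarith [sq_nonneg (cubicProb n
      (fun G => nonTreeFraction G p ≤ meanConst p / (ε / 2) / n) - 1)]
  · have h2 := abs_le.1 (abs_sub_treeTerm_le_of_cubic hn hG hPG γ β)
    have h3 := abs_le.1 (abs_sub_treeTerm_le_of_cubic hn hH hPH γ β)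
    rw [mul_div_assoc, abs_le]
    constructor <;> linarith

end RandomCubic

end QAOA

end

theorem mainTheorem1 (p : ℕ) :
    -- the objective function is the sum of the edge terms
    (∀ (V : Type) [Fintype V] (G : SimpleGraph V) (γ β : Fin p → ℝ),
      QAOA.objective G γ β = ∑ e ∈ G.edgeFinset, QAOA.edgeTerm G e γ β) ∧
    -- each edge term is determined by the radius `p` neighborhood of the edge
    (∀ (V W : Type) [Fintype V] [Fintype W] (G : SimpleGraph V) (H : SimpleGraph W),
      ∀ e ∈ G.edgeSet, ∀ f ∈ H.edgeSet, QAOA.SameNbhd G e H f p →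
        ∀ γ β : Fin p → ℝ, QAOA.edgeTerm G e γ β = QAOA.edgeTerm H f γ β) ∧
    -- in a 3-regular graph, an edge with a tree neighborhood contributes the tree term
    (∀ (V : Type) [Fintype V] (G : SimpleGraph V), G.IsRegularOfDegree 3 →
      ∀ e ∈ G.edgeSet, QAOA.IsTreeLike G e p →
        ∀ γ β : Fin p → ℝ, QAOA.edgeTerm G e γ β = QAOA.treeTerm γ β) ∧
    -- hence the objective per edge is close to the tree term if most neighborhoods are trees
    (∀ (V : Type) [Fintype V] [Nonempty V] (G : SimpleGraph V), G.IsRegularOfDegree 3 →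
      ∀ γ β : Fin p → ℝ,
        |QAOA.objectivePerEdge G γ β - QAOA.treeTerm γ β| ≤ QAOA.nonTreeFraction G p) ∧
    -- the mean fraction of edges whose neighborhood is not a tree is `O(1/n)`
    (∃ K : ℝ, ∀ n : ℕ, 4 ≤ n → Even n →
      QAOA.cubicMean n (fun G => QAOA.nonTreeFraction G p) ≤ K / n) ∧
    -- for typical graphs, the non-tree fraction and the deviation of the whole landscape from
    -- the tree term are of order `1/n`
    (∀ ε : ℝ, 0 < ε → ∃ K : ℝ, ∀ n : ℕ, 4 ≤ n → Even n →
      1 - ε ≤ QAOA.cubicProb n (fun G => QAOA.nonTreeFraction G p ≤ K / n ∧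
        ∀ γ β : Fin p → ℝ,
          |QAOA.objectivePerEdge G γ β - QAOA.treeTerm γ β| ≤ K / n)) ∧
    -- for almost all graphs the whole landscape agrees with the tree term up to `o(1)`
    (∀ δ : ℝ, 0 < δ →
      Tendsto (fun n => QAOA.cubicProb n (fun G => ∀ γ β : Fin p → ℝ,
          |QAOA.objectivePerEdge G γ β - QAOA.treeTerm γ β| ≤ δ))
        (atTop ⊓ 𝓟 {n : ℕ | Even n}) (𝓝 1)) ∧
    -- two independent typical instances have the same landscape up to order `1/n`
    (∀ ε : ℝ, 0 < ε → ∃ K : ℝ, ∀ n : ℕ, 4 ≤ n → Even n →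
      1 - ε ≤ QAOA.cubicPairProb n (fun G H => ∀ γ β : Fin p → ℝ,
        |QAOA.objectivePerEdge G γ β - QAOA.objectivePerEdge H γ β| ≤ K / n)) :=
  ⟨fun _ _ G γ β => QAOA.objective_eq_sum G γ β,
    fun _ _ _ _ _ _ _ _ _ _ h γ β => QAOA.edgeTerm_eq_of_sameNbhd h γ β,
    fun _ _ _ hG _ he ht γ β => QAOA.edgeTerm_eq_treeTerm hG he ht γ β,
    fun _ _ _ _ hG γ β => QAOA.abs_objectivePerEdge_sub_treeTerm_le hG γ β,
    ⟨QAOA.meanConst p, fun n hn _ => QAOA.cubicMean_nonTreeFraction_le p (by omega)⟩,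
    fun ε hε => ⟨QAOA.meanConst p / ε, fun n hn he =>
      (QAOA.le_cubicProb_nonTreeFraction p hn he hε).trans <| QAOA.cubicProb_mono fun _ hG h =>
        ⟨h, QAOA.abs_sub_treeTerm_le_of_cubic hn hG h⟩⟩,
    fun _ hδ => QAOA.tendsto_cubicProb p hδ,
    fun ε hε => ⟨2 * (QAOA.meanConst p / (ε / 2)), fun n hn he =>
      QAOA.le_cubicPairProb p hn he hε⟩⟩
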